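/- **Setting.** Let $d\in\{2,3\}$ and let $\Omega\subset\mathbb R^d$ be a polyhedral domain (open, connected) with a conforming partitioning $\mathcal T^h$ into finitely many disjoint open simplices $\sigma$, $\overline\Omega=\bigcup_\sigma\overline\sigma$. Let $\partial_D\Omega\subset\partial\Omega$ be such that either (a) $\partial_D\Omega=\partial\Omega$, or (b) $\partial_D\Omega=\emptyset$, or (c) $\Omega=(-H,H)^d$ and $\partial_D\Omega=[-H,H]^{d-1}\times\{H\}$ for some $H>0$; put $\partial_N\Omega=\partial\Omega\setminus\partial_D\Omega$. Let $S^h$ be the space of continuous functions on $\overline\Omega$ that are affine on each simplex, let $\pi^h$ be nodal interpolation into $S^h$, let $u_D\in\mathbb R$ be a constant, and let $$S^h_0=\{\chi\in S^h:\chi=0\text{ on }\partial_D\Omega\},\qquad S^h_D=\{\chi\in S^h:\chi=u_D\text{ on }\partial_D\Omega\}.$$ Let $(\cdot,\cdot)$ be the $L^2(\Omega)$ inner product and, for piecewise continuous $\eta_1,\eta_2$, let $(\eta_1,\eta_2)^h=\sum_{\sigma}\frac{|\sigma|}{d+1}\sum_{k=0}^d\lim_{\sigma\ni q\to p_k^\sigma}(\eta_1\eta_2)(q)$,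 where $p_0^\sigma,\dots,p_d^\sigma$ are the vertices of $\sigma$. Let $\gamma(p)=\sum_{\ell=1}^L\gamma_\ell(p)$ with $\gamma_\ell(p)=(p\cdot G_\ell p)^{1/2}$, $L\ge1$ and $G_\ell\in\mathbb R^{d\times d}$ symmetric positive definite, and let $$B_1(q)=\gamma(q)\sum_{\ell=1}^L\gamma_\ell(q)^{-1}G_\ell\ \ (q\ne0),\qquad B_1(0)=L\sum_{\ell=1}^LG_\ell.$$ Let $\beta:\mathbb R^d\to\mathbb R_{\ge0}$ be positively homogeneous of degree one and positive on $\mathbb R^d\setminus\{0\}$; let $\mu(p)=\gamma(p)/\beta(p)$ for $p\neq0$ and $\mu(0)=\bar\mu$ with $\min_{p\ne0}\gamma(p)/\beta(p)\le\bar\mu\le\max_{p\ne0}\gamma(p)/\beta(p)$. Let $\Psi(s)=\frac14(s^2-1)^2$, $\phi^+(s)=s^3$, $\phi^-(s)=-s$, $c_\Psi=\int_{-1}^1\sqrt{2\Psi(s)}\,ds$. Let $\vartheta,\rho\ge0$, let $\lambda,\alpha,a,\epsilon,\mathcal K_+,\mathcal K_-,\tau_n>0$ and $m\ge2$. Let $b(s)=\frac12(1+s)\mathcal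 K_++\frac12(1-s)\mathcal K_-$, and let $\widetilde b(s)=b(\max\{-1,\min\{1,s\}\})$. Let $\varrho=\varrho^++\varrho^-$ be one of * (i) $\varrho=\frac12$, $\varrho^+=0$; * (ii) $\varrho(s)=\frac12(1-s)$, $\varrho^+=0$; * (iii) $\varrho(s)=\frac{15}{16}(s^2-1)^2$, $\varrho^+(s)=\frac32s$; * (ii$^+$) $\varrho(s)=\frac12(1+s)$, $\varrho^+=0$; * (iii$^+$) $\varrho(s)=\frac{15}{16}(s^2-1)^2$, $\varrho^+(s)=-\frac32s$. Let $\widehat\varrho_m(s_0,s_1)=\varrho^-(s_0)+\varrho^+(\max\{-m,\min\{m,s_1\}\})$. **Scheme.** Given $\Phi^{n-1}\in S^h$ and, if $\vartheta>0$, $W^{n-1}\in S^h_D$, find $(\Phi^n,W^n)\in S^h\times S^h_D$ such that $$\vartheta\Bigl(\tfrac{W^n-W^{n-1}}{\tau_n},\chi\Bigr)^h+\lambda\Bigl(\widehat\varrho_m(\Phi^{n-1},\Phi^n)\tfrac{\Phi^n-\Phi^{n-1}}{\tau_n},\chi\Bigr)^h+\bigl(\pi^h[\widetilde b(\Phi^{n-1})]\nabla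 W^n,\nabla\chi\bigr)=0\quad\forall\chi\in S^h_0,$$ $$\epsilon\tfrac\rho\alpha\Bigl(\mu(\nabla\Phi^{n-1})\tfrac{\Phi^n-\Phi^{n-1}}{\tau_n},\chi\Bigr)^h+\epsilon\bigl(B_1(\nabla\Phi^{n-1})\nabla\Phi^n,\nabla\chi\bigr)+\epsilon^{-1}(\phi^+(\Phi^n),\chi)^h=\Bigl(c_\Psi\tfrac a\alpha\widehat\varrho_m(\Phi^{n-1},\Phi^n)W^n-\epsilon^{-1}\phi^-(\Phi^{n-1}),\chi\Bigr)^h\quad\forall\chi\in S^h.$$ **Claim.** A solution $(\Phi^n,W^n)\in S^h\times S^h_D$ exists, unless the splitting is (iii) or (iii$^+$) and both $\vartheta=0$ and $\partial_N\Omega=\partial\Omega$. Moreover, for the splittings (i), (ii) and (ii$^+$), $\Phi^n$ is unique and $W^n$ is unique up to an additive constant; and $(\Phi^n,W^n)$ is unique if $\vartheta>0$, or $\partial_N\Omega\ne\partial\Omega$, or $\varrho(\Phi^{n-1}(p))\neq0$ for at least one node $p$ of $\mathcal T^h$. -/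

import Mathlib

open MeasureTheory Topology
open scoped Matrix

noncomputable section

namespace PhaseFieldFEM

/-- Euclidean space `ℝ^d`. -/
abbrev Space (d : ℕ) : Type := EuclideanSpace ℝ (Fin d)

/-! ### Triangulations and finite element spaces -/

/-- The closed simplex with vertex set `s`. -/
def closedSimplex {d : ℕ} (s : Finset (Space d)) : Set (Space d) :=
  convexHull ℝ (s : Set (Space d))

/-- The open simplex with vertex set `s` (for a nondegenerate `d`-simplex `s` of `ℝ^d`). -/
def openSimplex {d : ℕ} (s : Finset (Space d)) : Set (Space d) :=
  interior (closedSimplex s)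

/-- A (conforming) partitioning of `Ω` into finitely many disjoint open simplices, each given by
its set of `d + 1` affinely independent vertices.  Two closed simplices meet exactly in the
simplex spanned by their common vertices (so that the standard nodal basis functions exist); in
particular distinct open simplices are disjoint. -/
structure Triangulation {d : ℕ} (Ω : Set (Space d)) where
  cells : Finset (Finset (Space d))
  card_eq : ∀ s ∈ cells, s.card = d + 1
  indep : ∀ s ∈ cells, AffineIndependent ℝ ((↑) : s → Space d)
  conforming : ∀ s ∈ cells, ∀ t ∈ cells, closedSimplex s ∩ closedSimplex t ⊆
    convexHull ℝ ((s : Set (Space d)) ∩ (t : Set (Space d)))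
  openSimplex_subset : ∀ s ∈ cells, openSimplex s ⊆ Ω
  closure_eq : closure Ω = ⋃ s ∈ cells, closedSimplex s

variable {d : ℕ} {Ω : Set (Space d)}

/-- The nodes `p_j`, `j ∈ J`, of the triangulation, as points of `closure Ω`. -/
def Triangulation.nodes (T : Triangulation Ω) : Set (closure Ω) :=
  {p | ∃ s ∈ T.cells, (p : Space d) ∈ s}

/-- The space `S^h` of continuous functions on `closure Ω` that are affine on every simplex. -/
def feSpace (T : Triangulation Ω) : Submodule ℝ C(closure Ω, ℝ) where
  carrier := {χ | ∀ s ∈ T.cells, ∃ A : Space d →ᵃ[ℝ] ℝ,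
    ∀ x : closure Ω, (x : Space d) ∈ closedSimplex s → χ x = A x}
  add_mem' := by
    intro f g hf hg s hs
    obtain ⟨A, hA⟩ := hf s hs
    obtain ⟨B, hB⟩ := hg s hs
    exact ⟨A + B, fun x hx => by simp [hA x hx, hB x hx]⟩
  zero_mem' := fun s _ => ⟨0, fun x _ => by simp⟩
  smul_mem' := by
    intro c f hf s hs
    obtain ⟨A, hA⟩ := hf s hs
    exact ⟨c • A, fun x hx => by simp [hA x hx]⟩

/-- `S^h_g := {χ ∈ S^h : χ = g on ∂_D Ω}` for a constant `g`; thus `S^h_D` is the case `g = u_D`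
and `S^h_0` is the case `g = 0`. -/
def feSpaceWithTrace (T : Triangulation Ω) (ΓD : Set (Space d)) (g : ℝ) : Set C(closure Ω, ℝ) :=
  {χ | χ ∈ feSpace T ∧ ∀ x : closure Ω, (x : Space d) ∈ ΓD → χ x = g}

/-- Existence of the nodal interpolant, for arbitrary nodal values. -/
theorem exists_nodalInterpolant (T : Triangulation Ω) (η : closure Ω → ℝ) :
    ∃ χ ∈ feSpace T, ∀ p ∈ T.nodes, χ p = η p := by
  classical
  let v : Space d → ℝ := Function.extend Subtype.val η 0
  have hv : ∀ x : closure Ω, v x = η x := fun x => Subtype.val_injective.extend_apply η 0 x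
  have haff : ∀ s ∈ T.cells, ∃ A : Space d →ᵃ[ℝ] ℝ, ∀ p ∈ s, A p = v p := by
    intro s hs
    have hspan : affineSpan ℝ (Set.range ((↑) : s → Space d)) = ⊤ := by
      rw [(T.indep s hs).affineSpan_eq_top_iff_card_eq_finrank_add_one]
      simp [T.card_eq s hs]
    let b : AffineBasis s ℝ (Space d) := ⟨_, T.indep s hs, hspan⟩
    refine ⟨∑ i : s, v i • b.coord i, fun p hp => ?_⟩
    have h1 : ∀ i : s, b.coord i p = if i = ⟨p, hp⟩ then 1 else 0 := fun i =>
      b.coord_apply i ⟨p, hp⟩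
    have h2 : ∀ F : Finset s, (∑ i ∈ F, v i • b.coord i) p = ∑ i ∈ F, v i * b.coord i p := by
      intro F
      induction F using Finset.induction_on with
      | empty => simp
      | insert a F ha ih => rw [Finset.sum_insert ha, Finset.sum_insert ha, ← ih]; simp
    rw [h2]
    simp [h1]
  choose! A hA using haff
  have hcons : ∀ s ∈ T.cells, ∀ t ∈ T.cells, ∀ x, x ∈ closedSimplex s → x ∈ closedSimplex t →
      A s x = A t x := by
    intro s hs t ht x hxs hxt
    have hx := T.conforming s hs t ht ⟨hxs, hxt⟩
    have hc : Convex ℝ {y | (A s - A t) y = 0} := by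
      have := (convex_singleton (𝕜 := ℝ) (0 : ℝ)).affine_preimage (A s - A t)
      exact this
    have hsub : (s : Set (Space d)) ∩ t ⊆ {y | (A s - A t) y = 0} := by
      rintro y ⟨hy1, hy2⟩
      simp [hA s hs y hy1, hA t ht y hy2]
    have := convexHull_min hsub hc hx
    simpa [sub_eq_zero] using this
  have hcov : ∀ x : closure Ω, ∃ s ∈ T.cells, (x : Space d) ∈ closedSimplex s := by
    intro x
    have hx : (x : Space d) ∈ ⋃ s ∈ T.cells, closedSimplex s :=
      T.closure_eq.subset x.2
    simpa using hx
  choose σ hσ hxσ using hcov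
  let f : closure Ω → ℝ := fun x => A (σ x) x
  have hf : ∀ s ∈ T.cells, ∀ x : closure Ω, (x : Space d) ∈ closedSimplex s → f x = A s x :=
    fun s hs x hx => hcons _ (hσ x) _ hs x (hxσ x) hx
  have hcont : Continuous f := by
    refine (locallyFinite_of_finite
      (fun s : T.cells => {x : closure Ω | (x : Space d) ∈ closedSimplex s.1})).continuous
      ?_ ?_ ?_
    · ext x
      simpa using ⟨σ x, hσ x, hxσ x⟩
    · intro s
      exact (s.1.finite_toSet.isCompact_convexHull ℝ).isClosed.preimage continuous_subtype_val
    · intro s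
      refine ContinuousOn.congr (f := fun x : closure Ω => A s.1 x) ?_ fun x hx => hf _ s.2 x hx
      exact ((A s.1).continuous_of_finiteDimensional.comp continuous_subtype_val).continuousOn
  refine ⟨⟨f, hcont⟩, fun s hs => ⟨A s, fun x hx => hf s hs x hx⟩, ?_⟩
  rintro p ⟨s, hs, hp⟩
  change f p = η p
  rw [hf s hs p (subset_convexHull ℝ _ hp), hA s hs _ hp, hv]

/-- The interpolation operator `π^h`; only the nodal values of `η` matter. -/
def interpolate (T : Triangulation Ω) (η : closure Ω → ℝ) : C(closure Ω, ℝ) :=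
  (exists_nodalInterpolant T η).choose

/-- Extension by zero to `ℝ^d` (only the values on `closure Ω` are ever used). -/
def extZero (χ : C(closure Ω, ℝ)) : Space d → ℝ := Function.extend Subtype.val χ 0

/-- The gradient `∇χ`; for `χ ∈ S^h` it exists, and is constant, in each open simplex. -/
def grad (χ : C(closure Ω, ℝ)) (x : Space d) : Space d := gradient (extZero χ) x

/-- The discrete semi-inner product `(η₁, η₂)^h` for functions that are piecewise continuous on
the triangulation: `∑_σ |σ| / (d + 1) ∑_k (η₁ η₂)((p_{j_k})^-)`, where `(p_{j_k})^-` denotes the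
limit at the vertex from within the open simplex `σ`. -/
def lumped (T : Triangulation Ω) (η₁ η₂ : Space d → ℝ) : ℝ :=
  ∑ s ∈ T.cells, volume.real (openSimplex s) / (d + 1) *
    ∑ p ∈ s, Filter.limUnder (𝓝[openSimplex s] p) (fun q => η₁ q * η₂ q)

/-! ### Boundary conditions -/

/-- The admissible choices of the Dirichlet boundary `ΓD = ∂_D Ω`: (i) all of `∂Ω`, (ii) none of
it (pure Neumann conditions), (iii) the face `x_d = H` of the cube `Ω = (-H, H)^d`. -/
def AdmissibleBoundary (Ω ΓD : Set (Space d)) : Prop :=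
  ΓD = frontier Ω ∨ ΓD = ∅ ∨
    ∃ H : ℝ, 0 < H ∧ Ω = {x | ∀ i : Fin d, x i ∈ Set.Ioo (-H) H} ∧
      ΓD = {x | ∀ i : Fin d, x i ∈ Set.Icc (-H) H ∧ ((i : ℕ) + 1 = d → x i = H)}

/-- The Neumann boundary `∂_N Ω`, the complement of the Dirichlet boundary in `∂Ω`. -/
def neumannBoundary (Ω ΓD : Set (Space d)) : Set (Space d) := frontier Ω \ ΓD

/-! ### Anisotropies -/

/-- `γ_ℓ(p) = (p · G_ℓ p)^(1/2)`. -/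
def gammaL (G : Matrix (Fin d) (Fin d) ℝ) (p : Space d) : ℝ :=
  Real.sqrt (p.ofLp ⬝ᵥ (G *ᵥ p.ofLp))

/-- `γ(p) = (∑_ℓ γ_ℓ(p)^r)^(1/r)`. -/
def gamma {L : ℕ} (r : ℝ) (G : Fin L → Matrix (Fin d) (Fin d) ℝ) (p : Space d) : ℝ :=
  (∑ l, gammaL (G l) p ^ r) ^ (1 / r)

open Classical in
/-- `γ_ℓ(p) / γ(p)`, with the convention that it is `1` if `p = 0`. -/
def gammaRatio {L : ℕ} (r : ℝ) (G : Fin L → Matrix (Fin d) (Fin d) ℝ) (l : Fin L)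
    (p : Space d) : ℝ :=
  if p = 0 then 1 else gammaL (G l) p / gamma r G p

open Classical in
/-- The matrix `B_r(q, p)` that linearizes the anisotropic operator `A' = γ γ'`. -/
def anisoB {L : ℕ} (r : ℝ) (G : Fin L → Matrix (Fin d) (Fin d) ℝ) (q p : Space d) :
    Matrix (Fin d) (Fin d) ℝ :=
  if q = 0 then (L : ℝ) ^ (1 / r) • ∑ l, gammaRatio r G l p ^ (r - 1) • G l
  else gamma r G q • ∑ l, (gammaRatio r G l p ^ (r - 1) * (gammaL (G l) q)⁻¹) • G l

/-- The mobility `β : ℝ^d → ℝ_{≥ 0}` is positive away from the origin and positively homogeneous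
of degree one. -/
structure IsMobility (β : Space d → ℝ) : Prop where
  nonneg : ∀ p, 0 ≤ β p
  pos : ∀ p, p ≠ 0 → 0 < β p
  homogeneous : ∀ t : ℝ, 0 < t → ∀ p, β (t • p) = t * β p

open Classical in
/-- The kinetic coefficient: `μ(p) = γ(p) / β(p)` for `p ≠ 0` and `μ(0) = μ₀`. -/
def kineticCoeff (γ β : Space d → ℝ) (μ₀ : ℝ) (p : Space d) : ℝ :=
  if p = 0 then μ₀ else γ p / β p

/-- `min_{p ≠ 0} γ(p)/β(p) ≤ μ₀ ≤ max_{p ≠ 0} γ(p)/β(p)`, phrased so that it does not presuppose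
that the two extrema are attained. -/
def IsKineticValueAtZero (γ β : Space d → ℝ) (μ₀ : ℝ) : Prop :=
  (∃ p, p ≠ 0 ∧ γ p / β p ≤ μ₀) ∧ (∃ p, p ≠ 0 ∧ μ₀ ≤ γ p / β p)

/-! ### Potential and shape functions -/

/-- The quartic double well potential. -/
def quarticPotential (s : ℝ) : ℝ := 1 / 4 * (s ^ 2 - 1) ^ 2

/-- `c_Ψ = ∫_{-1}^1 √(2 Ψ(s)) ds`. -/
def cPot (Ψ : ℝ → ℝ) : ℝ := ∫ s in (-1 : ℝ)..1, Real.sqrt (2 * Ψ s)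

/-- The implicit part `φ⁺` of the splitting of `Ψ'` for the quartic potential. -/
def phiPlus (s : ℝ) : ℝ := s ^ 3

/-- The explicit part `φ⁻` of the splitting of `Ψ'` for the quartic potential. -/
def phiMinus (s : ℝ) : ℝ := -s

/-- The five shape functions with their splittings `ϱ = ϱ⁺ + ϱ⁻`.  The suffix `Pos` marks the
variants intended for `u_D > 0`. -/
inductive Splitting
  | i
  | ii
  | iii
  | iiPos
  | iiiPos

/-- The shape function `ϱ`. -/
def Splitting.rho : Splitting → ℝ → ℝ
  | .i, _ => 1 / 2
  | .ii, s => 1 / 2 * (1 - s)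
  | .iii, s => 15 / 16 * (s ^ 2 - 1) ^ 2
  | .iiPos, s => 1 / 2 * (1 + s)
  | .iiiPos, s => 15 / 16 * (s ^ 2 - 1) ^ 2

/-- The implicit part `ϱ⁺`. -/
def Splitting.rhoPlus : Splitting → ℝ → ℝ
  | .i, _ => 0
  | .ii, _ => 0
  | .iii, s => 3 / 2 * s
  | .iiPos, _ => 0
  | .iiiPos, s => -(3 / 2) * s

/-- The explicit part `ϱ⁻ = ϱ - ϱ⁺`. -/
def Splitting.rhoMinus (S : Splitting) (s : ℝ) : ℝ := S.rho s - S.rhoPlus s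

/-- The truncation `ϱ⁺_m` of `ϱ⁺` outside `[-m, m]`. -/
def Splitting.rhoPlusCut (S : Splitting) (m s : ℝ) : ℝ :=
  if m ≤ s then S.rhoPlus m else if s ≤ -m then S.rhoPlus (-m) else S.rhoPlus s

/-- `ϱ̂_m(s₀, s₁) = ϱ⁻(s₀) + ϱ⁺_m(s₁)`. -/
def Splitting.rhoHat (S : Splitting) (m s₀ s₁ : ℝ) : ℝ := S.rhoMinus s₀ + S.rhoPlusCut m s₁

/-! ### The scheme -/

/-- The constants of the model, the time step size `τ` and the truncation parameter `m`. -/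
structure Parameters where
  ϑ : ℝ
  lam : ℝ
  ρ : ℝ
  α : ℝ
  a : ℝ
  ε : ℝ
  Kplus : ℝ
  Kminus : ℝ
  τ : ℝ
  m : ℝ
  ϑ_nonneg : 0 ≤ ϑ
  lam_pos : 0 < lam
  ρ_nonneg : 0 ≤ ρ
  α_pos : 0 < α
  a_pos : 0 < a
  ε_pos : 0 < ε
  Kplus_pos : 0 < Kplus
  Kminus_pos : 0 < Kminus
  τ_pos : 0 < τ
  two_le_m : 2 ≤ m

/-- `b(s) = (1 + s)/2 K₊ + (1 - s)/2 K₋`. -/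
def Parameters.b (P : Parameters) (s : ℝ) : ℝ :=
  1 / 2 * (1 + s) * P.Kplus + 1 / 2 * (1 - s) * P.Kminus

/-- `b̃`, which is `b` on `[-1, 1]` and is constant on either side of it. -/
def Parameters.bTilde (P : Parameters) (s : ℝ) : ℝ :=
  if 1 ≤ s then P.b 1 else if s ≤ -1 then P.b (-1) else P.b s

/-- The discrete heat equation: for all `χ ∈ S^h_0`,
`ϑ ((W - Wold)/τ, χ)^h + λ (ϱ̂_m(Φold, Φ) (Φ - Φold)/τ, χ)^h + (π^h[b̃(Φold)] ∇W, ∇χ) = 0`. -/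
def HeatEquation (T : Triangulation Ω) (ΓD : Set (Space d)) (P : Parameters) (S : Splitting)
    (Φold Wold Φ W : C(closure Ω, ℝ)) : Prop :=
  ∀ χ ∈ feSpaceWithTrace T ΓD 0,
    P.ϑ * lumped T (fun x => (extZero W x - extZero Wold x) / P.τ) (extZero χ)
    + P.lam * lumped T
        (fun x => S.rhoHat P.m (extZero Φold x) (extZero Φ x) *
          ((extZero Φ x - extZero Φold x) / P.τ)) (extZero χ)
    + (∫ x in Ω, inner ℝ
        (extZero (interpolate T (fun y => P.bTilde (Φold y))) x • grad W x) (grad χ x))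
    = 0

/-- The discrete Allen--Cahn equation for the quartic potential: for all `χ ∈ S^h`,
`ε ρ/α (μ(∇Φold) (Φ - Φold)/τ, χ)^h + ε (B_r(∇Φold, ∇Φ) ∇Φ, ∇χ) + ε⁻¹ (φ⁺(Φ), χ)^h`
`= (c_Ψ a/α ϱ̂_m(Φold, Φ) W - ε⁻¹ φ⁻(Φold), χ)^h`. -/
def AllenCahnEquation {L : ℕ} (T : Triangulation Ω) (r : ℝ)
    (G : Fin L → Matrix (Fin d) (Fin d) ℝ) (β : Space d → ℝ) (μ₀ : ℝ)
    (P : Parameters) (S : Splitting) (Φold Φ W : C(closure Ω, ℝ)) : Prop :=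
  ∀ χ ∈ feSpace T,
    P.ε * (P.ρ / P.α) * lumped T
        (fun x => kineticCoeff (gamma r G) β μ₀ (grad Φold x) *
          ((extZero Φ x - extZero Φold x) / P.τ))
        (extZero χ)
    + P.ε * (∫ x in Ω, inner ℝ
        (WithLp.toLp 2 (anisoB r G (grad Φold x) (grad Φ x) *ᵥ (grad Φ x).ofLp)) (grad χ x))
    + P.ε⁻¹ * lumped T (fun x => phiPlus (extZero Φ x)) (extZero χ)
    = lumped T
        (fun x => cPot quarticPotential * (P.a / P.α) *
            S.rhoHat P.m (extZero Φold x) (extZero Φ x) * extZero W x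
          - P.ε⁻¹ * phiMinus (extZero Φold x))
        (extZero χ)

/-- `(Φ, W) ∈ S^h × S^h_D` solves the scheme, given the data `Φold`, `Wold` of the previous time
level. -/
structure IsSolution {L : ℕ} (T : Triangulation Ω) (ΓD : Set (Space d)) (uD r : ℝ)
    (G : Fin L → Matrix (Fin d) (Fin d) ℝ) (β : Space d → ℝ) (μ₀ : ℝ)
    (P : Parameters) (S : Splitting) (Φold Wold Φ W : C(closure Ω, ℝ)) : Prop where
  mem_Φ : Φ ∈ feSpace T
  mem_W : W ∈ feSpaceWithTrace T ΓD uD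
  heat : HeatEquation T ΓD P S Φold Wold Φ W
  allenCahn : AllenCahnEquation T r G β μ₀ P S Φold Φ W

end PhaseFieldFEM

end

/-! In terms of the increments `Φ - Φold` and `W - uD`, the scheme asks for a zero of a continuous
map from a finite-dimensional space to its dual. Test the Allen–Cahn equation with the first
increment and a suitable multiple of the heat equation with the second: the coupling terms, both of
the form `ϱ̂ (Φ - Φold) (W - uD)`, cancel. What remains is the cubic term, coercive in the vertex
values of `Φ`, nonnegative quadratic forms, and a remainder of linear growth, because the truncation
keeps `ϱ̂` bounded. If the heat form is positive definite on the functions vanishing on `ΓD`, the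
map is coercive and Brouwer's theorem gives a zero (`exists_coupled_solution`).

If `ϑ = 0` and `ΓD` does not meet the closure of `Ω`, constants lie in the kernel of the heat form.
For the explicit splittings the heat equation tested with 1 is one linear constraint on the
increment of `Φ`. Solving with that constraint on `Φ` and zero mean for `W` leaves a Lagrange
multiplier in the Allen–Cahn equation, which a constant added to `W` absorbs (`exists_isSolution`).

For uniqueness with an explicit splitting, the same testing applied to the difference of two
solutions gives the coupling term both signs, so it is zero and every dissipative term vanishes: the
cubic one gives equality of the `Φ`, the Dirichlet energy a constant difference of the `W`
(`uniqueness_of_explicit_shape`).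

The Brouwer-type statement is proved analytically: for `f = id + g`, the integral of `h (x + t g x)
det (1 + t g'(x))` is a polynomial in `t` if `h` is a polynomial in the squared norm; by change of
variables it is constant for small `t`, hence for all `t`. -/

namespace PhaseFieldFEM
-- Zeros of continuous vector fields on finite-dimensional spaces.
section Brouwer

variable {E : Type*} [NormedAddCommGroup E] [InnerProductSpace ℝ E]

/-- Expanding the squared norm gives a quadratic in `t`. Coefficients in `C(E, ℝ)` let the product
with the determinant be integrated coefficient by coefficient. -/
theorem exists_polynomial_bump (g : E → E) (hg : Continuous g) (c : ℝ) (k : ℕ) :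
    ∃ P : Polynomial C(E, ℝ), ∀ (t : ℝ) (x : E),
      (P.eval (ContinuousMap.const E t)) x = (1 - c * ‖x + t • g x‖ ^ 2) ^ k := by
  let u : C(E, ℝ) := ⟨fun x => ‖x‖ ^ 2, by fun_prop⟩
  let v : C(E, ℝ) := ⟨fun x => 2 * inner ℝ x (g x), by fun_prop⟩
  let w : C(E, ℝ) := ⟨fun x => ‖g x‖ ^ 2, by fun_prop⟩
  refine ⟨(1 - Polynomial.C (ContinuousMap.const E c) * (Polynomial.C u + Polynomial.X *
    Polynomial.C v + Polynomial.X ^ 2 * Polynomial.C w)) ^ k, fun t x => ?_⟩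
  simp only [Polynomial.eval_pow, Polynomial.eval_sub, Polynomial.eval_one, Polynomial.eval_mul,
    Polynomial.eval_C, Polynomial.eval_add, Polynomial.eval_X, ContinuousMap.pow_apply,
    ContinuousMap.sub_apply, ContinuousMap.one_apply, ContinuousMap.mul_apply,
    ContinuousMap.const_apply, ContinuousMap.add_apply]
  rw [norm_add_sq_real, inner_smul_right, norm_smul]
  simp only [u, v, w, ContinuousMap.coe_mk, mul_pow, Real.norm_eq_abs, sq_abs]
  ring

variable [FiniteDimensional ℝ E]

/-- `det (1 + t A(x))` is a polynomial in `t` whose coefficients are continuous in `x`. -/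
theorem exists_polynomial_det (A : E → E →L[ℝ] E) (hA : Continuous A) :
    ∃ P : Polynomial C(E, ℝ), ∀ (t : ℝ) (x : E),
      (P.eval (ContinuousMap.const E t)) x = (ContinuousLinearMap.id ℝ E + t • A x).det := by
  classical
  let b := Module.finBasis ℝ E
  let N : Matrix (Fin (Module.finrank ℝ E)) (Fin (Module.finrank ℝ E)) C(E, ℝ) :=
    Matrix.of fun i j => ⟨fun x => b.repr (A x (b j)) i, by
      have h1 : Continuous fun x => A x (b j) := hA.clm_apply continuous_const
      exact ((b.coord i).continuous_of_finiteDimensional).comp h1⟩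
  let M : Matrix (Fin (Module.finrank ℝ E)) (Fin (Module.finrank ℝ E)) (Polynomial C(E, ℝ)) :=
    1 + (Polynomial.X : Polynomial C(E, ℝ)) • N.map Polynomial.C
  refine ⟨M.det, fun t x => ?_⟩
  let θ : Polynomial C(E, ℝ) →+* ℝ :=
    (ContinuousMap.evalAlgHom ℝ ℝ x : C(E, ℝ) →+* ℝ).comp
      (Polynomial.evalRingHom (ContinuousMap.const E t))
  have h1 : (M.det.eval (ContinuousMap.const E t)) x = θ M.det := rfl
  rw [h1, RingHom.map_det, ContinuousLinearMap.det, ← LinearMap.det_toMatrix b]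
  congr 1
  ext i j
  simp only [M, N, θ, LinearMap.toMatrix_apply, RingHom.mapMatrix_apply, Matrix.map_apply,
    Matrix.add_apply, Matrix.smul_apply, Matrix.one_apply]
  by_cases h : i = j
  · subst h
    simp
    exact mul_comm _ _
  · simp [h]
    exact mul_comm _ _

section MeanValue

variable [MeasurableSpace E] [BorelSpace E]

theorem exists_polynomial_integral (P : Polynomial C(E, ℝ)) (K : Set E) (hK : IsCompact K) :
    ∃ q : Polynomial ℝ, ∀ t : ℝ,
      q.eval t = ∫ x in K, (P.eval (ContinuousMap.const E t)) x := by
  induction P using Polynomial.induction_on' with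
  | add P Q hP hQ =>
    obtain ⟨p, hp⟩ := hP
    obtain ⟨q, hq⟩ := hQ
    refine ⟨p + q, fun t => ?_⟩
    rw [Polynomial.eval_add, hp, hq, ← integral_add]
    · simp
    · exact (ContinuousMap.continuous _).continuousOn.integrableOn_compact hK
    · exact (ContinuousMap.continuous _).continuousOn.integrableOn_compact hK
  | monomial n a =>
    refine ⟨Polynomial.monomial n (∫ x in K, a x), fun t => ?_⟩
    rw [Polynomial.eval_monomial, ← integral_mul_const]
    simp

/-- A small compactly supported perturbation of the identity is volume preserving on average. -/
theorem integral_comp_mul_det (g : E → E) (hg : ContDiff ℝ 1 g) {R : ℝ}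
    (hR : ∀ x, R ≤ ‖x‖ → g x = 0) {C : NNReal} (hC : LipschitzWith C g) {t : ℝ} (ht : 0 ≤ t)
    (htC : t * C < 1) (h : E → ℝ) :
    ∫ x in Metric.closedBall 0 R,
        h (x + t • g x) * (ContinuousLinearMap.id ℝ E + t • fderiv ℝ g x).det
      = ∫ x in Metric.closedBall 0 R, h x := by
  -- A perturbation of the identity with Lipschitz constant below 1 is bijective. It fixes every
  -- point of norm at least `R`, so it maps the ball onto itself and the change of variables formula
  -- applies.
  set f : E → E := fun x => x + t • g x with hf
  have hinj : Function.Injective f := by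
    intro x y hxy
    by_contra hne
    have h1 : x - y = t • (g y - g x) := by
      simp only [hf] at hxy
      rw [smul_sub, sub_eq_sub_iff_add_eq_add]
      rw [hxy]; abel
    have h2 : ‖x - y‖ ≤ t * C * ‖x - y‖ := by
      conv_lhs => rw [h1]
      rw [norm_smul, Real.norm_of_nonneg ht, mul_assoc, norm_sub_rev x y]
      gcongr
      have := hC.dist_le_mul y x
      rwa [dist_eq_norm, dist_eq_norm] at this
    have h3 : 0 < ‖x - y‖ := norm_pos_iff.2 (sub_ne_zero.2 hne)
    nlinarith
  have hout : ∀ x, R ≤ ‖x‖ → f x = x := fun x hx => by simp [hf, hR x hx]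
  have hsurj : Function.Surjective f := by
    intro y
    have hct : ContractingWith (t.toNNReal * C) fun x => y - t • g x := by
      refine ⟨by rw [← NNReal.coe_lt_coe]; simpa [ht] using htC, LipschitzWith.of_dist_le_mul fun a b => ?_⟩
      rw [dist_eq_norm]
      have h1 : y - t • g a - (y - t • g b) = t • (g b - g a) := by rw [smul_sub]; abel
      rw [h1, norm_smul, Real.norm_of_nonneg ht]
      have := hC.dist_le_mul b a
      rw [dist_eq_norm] at this
      rw [dist_comm]
      calc t * ‖g b - g a‖ ≤ t * (C * dist b a) := by gcongr
        _ = _ := by rw [NNReal.coe_mul, Real.coe_toNNReal _ ht, mul_assoc]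
    refine ⟨hct.fixedPoint, ?_⟩
    have := hct.fixedPoint_isFixedPt
    simp only [Function.IsFixedPt] at this
    simp only [hf]
    nth_rewrite 1 [← this]
    abel
  have himg : f '' Metric.closedBall 0 R = Metric.closedBall 0 R := by
    ext y
    simp only [Set.mem_image, mem_closedBall_zero_iff]
    constructor
    · rintro ⟨x, hx, rfl⟩
      by_contra hlt
      have := hinj (hout (f x) (not_le.1 hlt).le)
      rw [this] at hlt
      exact hlt hx
    · intro hy
      obtain ⟨x, rfl⟩ := hsurj y
      refine ⟨x, ?_, rfl⟩
      by_contra hlt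
      rw [hout x (not_le.1 hlt).le] at hy
      exact hlt hy
  have hder : ∀ x, HasFDerivAt f (ContinuousLinearMap.id ℝ E + t • fderiv ℝ g x) x := fun x =>
    (hasFDerivAt_id x).add (((hg.differentiable (by simp)) x).hasFDerivAt.const_smul t)
  have hdet : ∀ x, 0 < (ContinuousLinearMap.id ℝ E + t • fderiv ℝ g x).det := by
    intro x
    -- The determinant has no zero for `s` in `[0, t]` and equals 1 at `s = 0`, so it is positive;
    -- this removes the absolute value in the change of variables.
    have hne : ∀ s ∈ Set.Icc 0 t, (ContinuousLinearMap.id ℝ E + s • fderiv ℝ g x).det ≠ 0 := by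
      rintro s ⟨hs0, hst⟩ h0
      obtain ⟨v, hv, hv0⟩ := (LinearMap.bot_lt_ker_of_det_eq_zero h0).ne' |>
        (Submodule.ne_bot_iff _).1
      have h1 : v = -(s • fderiv ℝ g x v) := by
        rw [LinearMap.mem_ker] at hv
        exact eq_neg_of_add_eq_zero_left (by simpa using hv)
      have h2 : ‖v‖ ≤ s * C * ‖v‖ := by
        conv_lhs => rw [h1]
        rw [norm_neg, norm_smul, Real.norm_of_nonneg hs0, mul_assoc]
        gcongr
        exact (fderiv ℝ g x).le_of_opNorm_le (norm_fderiv_le_of_lipschitz ℝ hC) v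
      have h3 : 0 < ‖v‖ := norm_pos_iff.2 hv0
      have h4 : s * C ≤ t * C := by gcongr
      nlinarith
    have hcont : Continuous fun s : ℝ =>
        (ContinuousLinearMap.id ℝ E + s • fderiv ℝ g x).det :=
      ContinuousLinearMap.continuous_det.comp (by fun_prop)
    by_contra hlt
    have h0 : (ContinuousLinearMap.id ℝ E + (0 : ℝ) • fderiv ℝ g x).det = 1 := by
      simp [ContinuousLinearMap.det]
    obtain ⟨s, hs, hs0⟩ := intermediate_value_Icc' ht hcont.continuousOn
      (show (0 : ℝ) ∈ _ from ⟨not_lt.1 hlt, by rw [h0]; exact zero_le_one⟩)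
    exact hne s hs hs0
  have key := integral_image_eq_integral_abs_det_fderiv_smul (volume : Measure E)
    (s := Metric.closedBall 0 R) measurableSet_closedBall
    (fun x _ => (hder x).hasFDerivWithinAt) hinj.injOn h
  rw [himg] at key
  rw [key]
  refine integral_congr_ae (Filter.Eventually.of_forall fun x => ?_)
  simp only [smul_eq_mul, abs_of_pos (hdet x)]
  rw [mul_comm]

/-- A `C¹` map which is the identity outside a ball has a zero. -/
theorem exists_eq_zero_of_eq_id_outside (f : E → E) (hf : ContDiff ℝ 1 f) {R : ℝ} (hR0 : 0 < R)
    (hR : ∀ x, R ≤ ‖x‖ → f x = x) : ∃ x, f x = 0 := by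
  by_contra! hne
  set B : Set E := Metric.closedBall 0 R with hB
  have hBc : IsCompact B := isCompact_closedBall 0 R
  have hB0 : (0 : E) ∈ B := by simp [hB, hR0.le]
  let g : E → E := fun x => f x - x
  have hg : ContDiff ℝ 1 g := hf.sub contDiff_id
  have hg0 : ∀ x, R ≤ ‖x‖ → g x = 0 := fun x hx => by simp [g, hR x hx]
  have hgs : HasCompactSupport g := by
    refine HasCompactSupport.intro hBc fun x hx => hg0 x ?_
    simp only [hB, mem_closedBall_zero_iff, not_le] at hx
    exact hx.le
  obtain ⟨C, hC⟩ := ContDiff.lipschitzWith_of_hasCompactSupport hgs hg (by simp)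
  obtain ⟨M₀, hM₀⟩ := hBc.exists_bound_of_continuousOn hf.continuous.continuousOn
  set M := max M₀ R
  have hM0 : 0 < M := lt_max_of_lt_right hR0
  obtain ⟨x₀, -, hx₀⟩ := hBc.exists_isMinOn ⟨0, hB0⟩ hf.continuous.norm.continuousOn
  -- The cap by `R` keeps the ball of radius `δ / 2` inside `B` and ensures `δ ≤ M`.
  set δ := min ‖f x₀‖ R
  have hδ0 : 0 < δ := lt_min (norm_pos_iff.2 (hne x₀)) hR0
  have hδ : ∀ x ∈ B, δ ≤ ‖f x‖ := fun x hx => (min_le_left _ _).trans (hx₀ hx)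
  have hδM : δ ≤ M := (min_le_right _ _).trans (le_max_right _ _)
  have hA : Continuous (fderiv ℝ g) := hg.continuous_fderiv (by simp)
  obtain ⟨P₁, hP₁⟩ := exists_polynomial_det _ hA
  have hdetc : Continuous fun x => (ContinuousLinearMap.id ℝ E + (1 : ℝ) • fderiv ℝ g x).det :=
    ContinuousLinearMap.continuous_det.comp (by fun_prop)
  obtain ⟨D, hD⟩ := hBc.exists_bound_of_continuousOn hdetc.continuousOn
  -- The left side is the value at `t = 1` of a polynomial in `t` that is constant on a small
  -- interval, hence constant. Change of variables alone would not reach `t = 1`, where injectivity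
  -- may fail.
  have hint : ∀ k : ℕ, ∫ x in B, (1 - (M ^ 2)⁻¹ * ‖f x‖ ^ 2) ^ k *
      (ContinuousLinearMap.id ℝ E + (1 : ℝ) • fderiv ℝ g x).det
      = ∫ x in B, (1 - (M ^ 2)⁻¹ * ‖x‖ ^ 2) ^ k := by
    intro k
    obtain ⟨P₂, hP₂⟩ := exists_polynomial_bump g hg.continuous (M ^ 2)⁻¹ k
    obtain ⟨q, hq⟩ := exists_polynomial_integral (P₂ * P₁) B hBc
    have hq' : ∀ t : ℝ, q.eval t = ∫ x in B, (1 - (M ^ 2)⁻¹ * ‖x + t • g x‖ ^ 2) ^ k *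
        (ContinuousLinearMap.id ℝ E + t • fderiv ℝ g x).det := by
      intro t
      rw [hq]
      simp only [Polynomial.eval_mul, ContinuousMap.mul_apply, hP₁, hP₂]
    set c := ∫ x in B, (1 - (M ^ 2)⁻¹ * ‖x‖ ^ 2) ^ k
    have hqc : q = Polynomial.C c := by
      refine Polynomial.eq_of_infinite_eval_eq _ _
        ((Set.Icc_infinite (show (0 : ℝ) < ((C : ℝ) + 1)⁻¹ by positivity)).mono ?_)
      rintro t ⟨ht0, ht1⟩
      have htC : t * C < 1 := by
        calc t * C ≤ ((C : ℝ) + 1)⁻¹ * C := by gcongr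
          _ < 1 := by
            rw [inv_mul_lt_iff₀ (by positivity)]
            linarith
      change q.eval t = _
      rw [hq', Polynomial.eval_C]
      exact integral_comp_mul_det g hg hg0 hC ht0 htC fun y => (1 - (M ^ 2)⁻¹ * ‖y‖ ^ 2) ^ k
    have h1 := hq' 1
    rw [hqc, Polynomial.eval_C] at h1
    rw [h1]
    refine integral_congr_ae (Filter.Eventually.of_forall fun x => ?_)
    simp [g]
  -- If `f` has no zero, the bump along `f` is at most `b`, while at the identity it is at least `a
  -- > b` on a ball of positive volume. Equality of the integrals of the `k`-th powers fails for
  -- large `k`.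
  set b := 1 - (M ^ 2)⁻¹ * δ ^ 2
  set a := 1 - (M ^ 2)⁻¹ * (δ / 2) ^ 2
  have hba : b < a := by
    simp only [a, b]
    have : 0 < (M ^ 2)⁻¹ * δ ^ 2 := by positivity
    nlinarith
  have hb0 : 0 ≤ b := by
    simp only [b, sub_nonneg]
    rw [inv_mul_le_iff₀ (by positivity), mul_one]
    gcongr
  have ha0 : 0 < a := hb0.trans_lt hba
  have hvol : 0 < volume.real (Metric.ball (0 : E) (δ / 2)) :=
    ENNReal.toReal_pos (Metric.measure_ball_pos volume 0 (by positivity)).ne'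
      measure_ball_lt_top.ne
  have hD0 : 0 ≤ D := (norm_nonneg _).trans (hD 0 hB0)
  have hkey : ∀ k : ℕ, volume.real (Metric.ball (0 : E) (δ / 2)) * a ^ k
      ≤ D * volume.real B * b ^ k := by
    intro k
    have h1 : volume.real (Metric.ball (0 : E) (δ / 2)) * a ^ k
        ≤ ∫ x in B, (1 - (M ^ 2)⁻¹ * ‖x‖ ^ 2) ^ k := by
      have hsub : Metric.ball (0 : E) (δ / 2) ⊆ B := by
        intro x hx
        simp only [hB, mem_closedBall_zero_iff]
        rw [mem_ball_zero_iff] at hx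
        have := min_le_right ‖f x₀‖ R
        linarith
      have hci : IntegrableOn (fun x : E => (1 - (M ^ 2)⁻¹ * ‖x‖ ^ 2) ^ k) B :=
        ContinuousOn.integrableOn_compact hBc (by fun_prop)
      calc volume.real (Metric.ball (0 : E) (δ / 2)) * a ^ k
          = ∫ x in Metric.ball (0 : E) (δ / 2), a ^ k := by simp
        _ ≤ ∫ x in Metric.ball (0 : E) (δ / 2), (1 - (M ^ 2)⁻¹ * ‖x‖ ^ 2) ^ k := by
            refine setIntegral_mono_on (by simp [measure_ball_lt_top]) (hci.mono_set hsub) measurableSet_ball ?_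
            intro x hx
            rw [mem_ball_zero_iff] at hx
            simp only [a]
            gcongr
        _ ≤ _ := by
            refine setIntegral_mono_set hci ?_ hsub.eventuallyLE
            refine (ae_restrict_iff' measurableSet_closedBall).2
              (Filter.Eventually.of_forall fun x hx => ?_)
            rw [mem_closedBall_zero_iff] at hx
            refine pow_nonneg ?_ k
            rw [sub_nonneg, inv_mul_le_iff₀ (by positivity), mul_one]
            have : R ≤ M := le_max_right _ _
            gcongr
            exact hx.trans this
    refine h1.trans ((le_abs_self _).trans ?_)
    rw [← hint k, ← Real.norm_eq_abs]
    have hbound : ∀ x ∈ B, ‖(1 - (M ^ 2)⁻¹ * ‖f x‖ ^ 2) ^ k *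
        (ContinuousLinearMap.id ℝ E + (1 : ℝ) • fderiv ℝ g x).det‖ ≤ b ^ k * D := by
      intro x hx
      rw [norm_mul, norm_pow]
      have h2 : ‖f x‖ ≤ M := (hM₀ x hx).trans (le_max_left _ _)
      have h3 : 0 ≤ 1 - (M ^ 2)⁻¹ * ‖f x‖ ^ 2 := by
        rw [sub_nonneg, inv_mul_le_iff₀ (by positivity), mul_one]
        gcongr
      gcongr
      · rw [Real.norm_of_nonneg h3]
        simp only [b]
        gcongr
        exact hδ x hx
      · exact hD x hx
    refine (norm_setIntegral_le_of_norm_le_const hBc.measure_lt_top hbound).trans (le_of_eq ?_)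
    ring
  obtain ⟨k, hk⟩ := exists_pow_lt_of_lt_one
    (show 0 < volume.real (Metric.ball (0 : E) (δ / 2)) / (D * volume.real B + 1) by positivity)
    ((div_lt_one ha0).2 hba)
  rw [div_pow, div_lt_div_iff₀ (by positivity) (by positivity)] at hk
  have h1 := hkey k
  have h2 : 0 ≤ b ^ k := by positivity
  nlinarith

end MeanValue

/-- A continuous vector field that points outwards near infinity has a zero. -/
theorem exists_eq_zero_of_inner_pos (F : E → E) (hF : Continuous F) (R : ℝ)
    (hpos : ∀ x, R ≤ ‖x‖ → 0 < inner ℝ (F x) x) : ∃ x, F x = 0 := by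
  borelize E
  by_contra! hne
  wlog hR0 : 0 < R generalizing R
  · exact this 1 (fun x hx => hpos x (by linarith)) one_pos
  set B : Set E := Metric.closedBall 0 (R + 1) with hB
  have hBc : IsCompact B := isCompact_closedBall 0 (R + 1)
  obtain ⟨x₀, -, hx₀⟩ := hBc.exists_isMinOn
    ⟨0, by simp only [hB, mem_closedBall_zero_iff, norm_zero]; linarith⟩ hF.norm.continuousOn
  set K : Set E := B ∩ {x | R ≤ ‖x‖}
  have hKc : IsCompact K := hBc.inter_right (isClosed_le continuous_const continuous_norm)
  obtain ⟨δ, hδ0, hδ⟩ : ∃ δ > 0, ∀ x ∈ K, δ ≤ inner ℝ (F x) x := by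
    rcases K.eq_empty_or_nonempty with h | h
    · exact ⟨1, one_pos, by simp [h]⟩
    · obtain ⟨y, hy, hmin⟩ := hKc.exists_isMinOn h
        (show ContinuousOn (fun x => inner ℝ (F x) x) K by fun_prop)
      exact ⟨_, hpos y hy.2, fun x hx => hmin hx⟩
  -- The first bound keeps the smooth approximation nonzero on the inner ball, the second keeps it
  -- pointing outwards on the shell between radii `R` and `R + 1`.
  set η := min (‖F x₀‖ / 2) (δ / (2 * (R + 1)))
  have hη0 : 0 < η := lt_min (by have := norm_pos_iff.2 (hne x₀); positivity) (by positivity)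
  obtain ⟨G, hG, hGF⟩ : ∃ G : E → E, ContDiff ℝ 1 G ∧ ∀ x ∈ B, ‖G x - F x‖ ≤ η := by
    -- Mollification at a scale of at most 1 sees, from a point of `B`, only the ball of radius `R +
    -- 2`.
    obtain ⟨r, hr0, hr⟩ := Metric.uniformContinuousOn_iff.1
      ((isCompact_closedBall (0 : E) (R + 2)).uniformContinuousOn_of_continuous
        hF.continuousOn) η hη0
    obtain ⟨G, hG, h⟩ := hF.exists_contDiff_dist_le_of_forall_mem_ball_dist_le
      (show 0 < min r 1 by positivity)
    refine ⟨G, hG.of_le (by simp), fun x hx => ?_⟩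
    rw [← dist_eq_norm]
    refine h x η fun y hy => ?_
    rw [Metric.mem_ball] at hy
    simp only [hB, Metric.mem_closedBall] at hx
    refine (hr y ?_ x ?_ (hy.trans_le (min_le_left _ _))).le
    · have := dist_triangle y x 0
      have := hy.trans_le (min_le_right _ _)
      rw [Metric.mem_closedBall]
      linarith
    · rw [Metric.mem_closedBall]
      linarith
  -- The glued map is `G` on the inner ball and the identity outside radius `R + 1`. On the shell it
  -- is a convex combination of two outward fields, so a zero can only be a zero of `G` in the inner
  -- ball.
  let ψ : ContDiffBump (0 : E) := ⟨R, R + 1, hR0, by linarith⟩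
  let f : E → E := fun x => ψ x • G x + (1 - ψ x) • x
  have hf : ContDiff ℝ 1 f := by
    have : ContDiff ℝ 1 ψ := ψ.contDiff
    exact (this.smul hG).add ((contDiff_const.sub this).smul contDiff_id)
  obtain ⟨x, hx⟩ := exists_eq_zero_of_eq_id_outside f hf (show 0 < R + 1 by linarith) (by
    intro x hx
    have : ψ x = 0 := ψ.zero_of_le_dist (by simpa using hx)
    simp [f, this])
  have hfx : f x = ψ x • G x + (1 - ψ x) • x := rfl
  by_cases h1 : ‖x‖ ≤ R
  · have h2 : ψ x = 1 := ψ.one_of_mem_closedBall (by simpa using h1)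
    rw [hfx, h2] at hx
    have hxB : x ∈ B := by
      rw [hB, mem_closedBall_zero_iff]
      linarith
    have h3 := hGF x hxB
    have h4 : G x = 0 := by simpa using hx
    have h5 : ‖F x₀‖ ≤ ‖F x‖ := hx₀ hxB
    rw [h4, zero_sub, norm_neg] at h3
    have h6 : 0 < ‖F x₀‖ := norm_pos_iff.2 (hne x₀)
    have := min_le_left (‖F x₀‖ / 2) (δ / (2 * (R + 1)))
    linarith
  · rw [not_le] at h1
    by_cases h2 : R + 1 ≤ ‖x‖
    · have h3 : ψ x = 0 := ψ.zero_of_le_dist (by simpa using h2)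
      rw [hfx, h3] at hx
      have : x = 0 := by simpa using hx
      rw [this, norm_zero] at h1
      linarith
    · rw [not_le] at h2
      have hxB : x ∈ B := by
        rw [hB, mem_closedBall_zero_iff]
        linarith
      have h3 : δ ≤ inner ℝ (F x) x := hδ x ⟨hxB, h1.le⟩
      have h4 : |inner ℝ (G x - F x) x| ≤ η * (R + 1) :=
        (abs_real_inner_le_norm _ _).trans (by gcongr; exact hGF x hxB)
      have h5 : η * (R + 1) ≤ δ / 2 := by
        calc η * (R + 1) ≤ δ / (2 * (R + 1)) * (R + 1) := by
              gcongr; exact min_le_right _ _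
          _ = δ / 2 := by field_simp
      rw [inner_sub_left, abs_le] at h4
      have h6 : 0 < inner ℝ (G x) x := by linarith [h4.1]
      have h7 : inner ℝ (f x) x = ψ x * inner ℝ (G x) x + (1 - ψ x) * ‖x‖ ^ 2 := by
        rw [hfx, inner_add_left, inner_smul_left, inner_smul_left, real_inner_self_eq_norm_sq]
        simp
      rw [hx, inner_zero_left] at h7
      have h8 : 0 ≤ ψ x := ψ.nonneg
      have h9 : ψ x ≤ 1 := ψ.le_one
      have h10 : 0 < ‖x‖ ^ 2 := by
        have : 0 < ‖x‖ := by linarith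
        positivity
      rcases h8.eq_or_lt with h | h
      · rw [← h] at h7
        linarith
      · have := mul_pos h h6
        have := mul_nonneg (sub_nonneg.2 h9) h10.le
        linarith

end Brouwer

/-- Zeros of coercive continuous maps from a finite dimensional space to its dual. -/
theorem exists_eq_zero_of_coercive {V : Type*} [NormedAddCommGroup V] [NormedSpace ℝ V]
    [FiniteDimensional ℝ V] (F : V → V →ₗ[ℝ] ℝ) (hF : ∀ v, Continuous fun x => F x v) (R : ℝ)
    (hpos : ∀ x, R ≤ ‖x‖ → 0 < F x x) : ∃ x, F x = 0 := by
  let e : V ≃L[ℝ] EuclideanSpace ℝ (Fin (Module.finrank ℝ V)) :=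
    ContinuousLinearEquiv.ofFinrankEq (by simp)
  let b := EuclideanSpace.basisFun (Fin (Module.finrank ℝ V)) ℝ
  -- The Riesz representative of the functional in Euclidean coordinates.
  let H : EuclideanSpace ℝ (Fin (Module.finrank ℝ V)) → EuclideanSpace ℝ _ := fun y =>
    ∑ i, F (e.symm y) (e.symm (b i)) • b i
  have hH : Continuous H :=
    continuous_finsetSum _ fun i _ => ((hF _).comp e.symm.continuous).smul continuous_const
  have hinner : ∀ y z, inner ℝ (H y) z = F (e.symm y) (e.symm z) := by
    intro y z
    simp only [H, sum_inner, inner_smul_left]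
    conv_rhs => rw [← b.sum_repr' z]
    simp [mul_comm]
  obtain ⟨y, hy⟩ := exists_eq_zero_of_inner_pos H hH (max (‖(e : V →L[ℝ] EuclideanSpace ℝ (Fin (Module.finrank ℝ V)))‖ * R) 0 + 1) (by
    intro y hy
    rw [hinner]
    refine hpos _ ?_
    by_contra hlt
    rw [not_le] at hlt
    have h1 : ‖y‖ ≤ ‖(e : V →L[ℝ] EuclideanSpace ℝ (Fin (Module.finrank ℝ V)))‖ * ‖e.symm y‖ := by
      simpa using (e : V →L[ℝ] EuclideanSpace ℝ (Fin (Module.finrank ℝ V))).le_opNorm (e.symm y)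
    have h2 : ‖(e : V →L[ℝ] EuclideanSpace ℝ (Fin (Module.finrank ℝ V)))‖ * ‖e.symm y‖
      ≤ ‖(e : V →L[ℝ] EuclideanSpace ℝ (Fin (Module.finrank ℝ V)))‖ * R := by gcongr
    have := le_max_left (‖(e : V →L[ℝ] EuclideanSpace ℝ (Fin (Module.finrank ℝ V)))‖ * R) 0
    linarith)
  refine ⟨e.symm y, LinearMap.ext fun v => ?_⟩
  have := hinner y (e v)
  rw [hy, inner_zero_left] at this
  simpa using this.symm

end PhaseFieldFEM

/-! ### The abstract coupled system. -/

namespace PhaseFieldFEM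
section CoupledSystem

theorem continuous_bilin_diag {V : Type*} [NormedAddCommGroup V] [NormedSpace ℝ V]
    [FiniteDimensional ℝ V] (K : V →ₗ[ℝ] V →ₗ[ℝ] ℝ) : Continuous fun v => K v v := by
  have h : Continuous fun v => LinearMap.toContinuousLinearMap (K v) :=
    ((LinearMap.toContinuousLinearMap : (V →ₗ[ℝ] ℝ) ≃ₗ[ℝ] V →L[ℝ] ℝ).toLinearMap ∘ₗ
      K).continuous_of_finiteDimensional
  exact h.clm_apply continuous_id

/-- The diagonal of the form is homogeneous of degree two, so its minimum over the compact unit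
sphere serves as the constant; an empty sphere means that the space is trivial. -/
theorem exists_coercive_const {V : Type*} [NormedAddCommGroup V] [NormedSpace ℝ V]
    [FiniteDimensional ℝ V] (K : V →ₗ[ℝ] V →ₗ[ℝ] ℝ) (hK : ∀ v, v ≠ 0 → 0 < K v v) :
    ∃ c > 0, ∀ v, c * ‖v‖ ^ 2 ≤ K v v := by
  rcases (Metric.sphere (0 : V) 1).eq_empty_or_nonempty with h | h
  · refine ⟨1, one_pos, fun v => ?_⟩
    by_cases hv : v = 0
    · simp [hv]
    · have : ‖v‖⁻¹ • v ∈ Metric.sphere (0 : V) 1 := by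
        simp [norm_smul, norm_ne_zero_iff.2 hv]
      simp [h] at this
  · obtain ⟨u, hu, hmin⟩ := (isCompact_sphere (0 : V) 1).exists_isMinOn h
      (continuous_bilin_diag K).continuousOn
    have hu0 : u ≠ 0 := by
      rintro rfl
      simp at hu
    refine ⟨K u u, hK u hu0, fun v => ?_⟩
    by_cases hv : v = 0
    · simp [hv]
    · have h1 : 0 < ‖v‖ := norm_pos_iff.2 hv
      have h2 : K u u ≤ K (‖v‖⁻¹ • v) (‖v‖⁻¹ • v) :=
        hmin (by simp [norm_smul, h1.ne'] : ‖v‖⁻¹ • v ∈ Metric.sphere (0 : V) 1)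
      simp only [map_smul, LinearMap.smul_apply, smul_eq_mul] at h2
      rw [← mul_assoc, ← sq, inv_pow, le_inv_mul_iff₀ (by positivity)] at h2
      linarith

theorem abs_le_of_linear {V : Type*} [NormedAddCommGroup V] [NormedSpace ℝ V]
    [FiniteDimensional ℝ V] (f : V →ₗ[ℝ] ℝ) : ∃ C ≥ 0, ∀ v, |f v| ≤ C * ‖v‖ :=
  ⟨‖LinearMap.toContinuousLinearMap f‖, norm_nonneg _,
    fun v => (LinearMap.toContinuousLinearMap f).le_opNorm v⟩

/-- The difference of the cubic terms is `t² (t² / 4 + 3 (t / 2 + a)²)`, and `t⁴ / 4 ≥ t² / 2 - 1 /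
4`. The term linear in `t` is kept exact, to be absorbed in the lower order part. -/
theorem cube_mul_lower_bound (a t : ℝ) : t ^ 2 / 2 - 1 / 4 + a ^ 3 * t ≤ (a + t) ^ 3 * t := by
  nlinarith [mul_nonneg (sq_nonneg t) (sq_nonneg (t / 2 + a)), sq_nonneg (t ^ 2 - 1)]

/-- Solvability of the coupled system, in abstract form: `p` and `q` are point evaluations with
quadrature weights `m`. -/
theorem exists_coupled_solution {X Y ι : Type*} [NormedAddCommGroup X] [NormedSpace ℝ X]
    [FiniteDimensional ℝ X] [NormedAddCommGroup Y] [NormedSpace ℝ Y] [FiniteDimensional ℝ Y]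
    [Fintype ι] (p : ι → X →ₗ[ℝ] ℝ) (hp : ∀ x, (∀ i, p i x = 0) → x = 0) (q : ι → Y →ₗ[ℝ] ℝ)
    (m a : ι → ℝ) (hm : ∀ i, 0 < m i) (g : ι → ℝ → ℝ) (hg : ∀ i, Continuous (g i))
    (C : ℝ) (hC : ∀ i s, |g i s| ≤ C)
    (A : X →ₗ[ℝ] X →ₗ[ℝ] ℝ) (hA : ∀ x, 0 ≤ A x x)
    (K : Y →ₗ[ℝ] Y →ₗ[ℝ] ℝ) (hK : ∀ y, y ≠ 0 → 0 < K y y)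
    (ℓ : X →ₗ[ℝ] ℝ) (ℓ' : Y →ₗ[ℝ] ℝ) (c₁ κ c₂ u : ℝ) (hc₁ : 0 < c₁) (hκ : 0 < κ)
    (hc₂ : 0 < c₂) :
    ∃ x y, (∀ χ, A x χ + ℓ χ + c₁ * ∑ i, m i * ((a i + p i x) ^ 3 * p i χ)
        = κ * ∑ i, m i * (g i (p i x) * (q i y + u) * p i χ)) ∧
      (∀ χ, K y χ + ℓ' χ + c₂ * ∑ i, m i * (g i (p i x) * p i x * q i χ) = 0) := by
  let fX : X × Y → X →ₗ[ℝ] ℝ := fun z => A z.1 + ℓ + c₁ • ∑ i, (m i * (a i + p i z.1) ^ 3) • p i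
    - κ • ∑ i, (m i * (g i (p i z.1) * (q i z.2 + u))) • p i
  let fY : X × Y → Y →ₗ[ℝ] ℝ := fun z => K z.2 + ℓ' +
    c₂ • ∑ i, (m i * (g i (p i z.1) * p i z.1)) • q i
  -- With the weight `κ / c₂`, the terms containing `g * p * q` cancel on the diagonal.
  let F : X × Y → X × Y →ₗ[ℝ] ℝ := fun z =>
    fX z ∘ₗ LinearMap.fst ℝ X Y + (κ / c₂) • fY z ∘ₗ LinearMap.snd ℝ X Y
  have hF : ∀ z v, F z v = (A z.1 v.1 + ℓ v.1 + c₁ * ∑ i, m i * (a i + p i z.1) ^ 3 * p i v.1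
      - κ * ∑ i, m i * (g i (p i z.1) * (q i z.2 + u)) * p i v.1) + κ / c₂ *
      (K z.2 v.2 + ℓ' v.2 + c₂ * ∑ i, m i * (g i (p i z.1) * p i z.1) * q i v.2) := by
    intro z v
    simp [F, fX, fY, LinearMap.sum_apply]
  have hpc : ∀ i, Continuous (p i) := fun i => (p i).continuous_of_finiteDimensional
  have hqc : ∀ i, Continuous (q i) := fun i => (q i).continuous_of_finiteDimensional
  have hAc : ∀ v, Continuous fun x => A x v := fun v =>
    (A.flip v).continuous_of_finiteDimensional
  have hKc : ∀ v, Continuous fun y => K y v := fun v =>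
    (K.flip v).continuous_of_finiteDimensional
  have hFc : ∀ v, Continuous fun z => F z v := by
    intro v
    simp only [hF]
    have h1 : ∀ i, Continuous fun z : X × Y => p i z.1 := fun i => (hpc i).comp continuous_fst
    have h2 : ∀ i, Continuous fun z : X × Y => q i z.2 := fun i => (hqc i).comp continuous_snd
    have h3 : Continuous fun z : X × Y => A z.1 v.1 := (hAc _).comp continuous_fst
    have h4 : Continuous fun z : X × Y => K z.2 v.2 := (hKc _).comp continuous_snd
    have h5 : ∀ i, Continuous fun z : X × Y => g i (p i z.1) := fun i => (hg i).comp (h1 i)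
    fun_prop
  obtain ⟨cY, hcY0, hcY⟩ := exists_coercive_const K hK
  -- The quadrature form is positive definite since the `p i` separate points, so the cubic term
  -- controls the norm of `X` and `A` need only be nonnegative.
  let Q : X →ₗ[ℝ] X →ₗ[ℝ] ℝ := ∑ i, m i • (LinearMap.mul ℝ ℝ).compl₁₂ (p i) (p i)
  have hQ : ∀ x, Q x x = ∑ i, m i * (p i x) ^ 2 := by
    intro x
    simp [Q, LinearMap.sum_apply, sq]
  obtain ⟨cX, hcX0, hcX⟩ := exists_coercive_const Q (by
    intro x hx
    rw [hQ]
    have : ∃ i, p i x ≠ 0 := by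
      by_contra! h
      exact hx (hp x h)
    obtain ⟨i, hi⟩ := this
    exact Finset.sum_pos' (fun j _ => by have := hm j; positivity)
      ⟨i, Finset.mem_univ i, by have := hm i; positivity⟩)
  obtain ⟨C₁, hC₁0, hC₁⟩ := abs_le_of_linear (ℓ + c₁ • ∑ i, (m i * a i ^ 3) • p i)
  obtain ⟨C₂, hC₂0, hC₂⟩ := abs_le_of_linear ℓ'
  have hC₃ : ∀ i, ∃ D ≥ 0, ∀ x, |p i x| ≤ D * ‖x‖ := fun i => abs_le_of_linear (p i)
  choose D hD0 hD using hC₃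
  -- The part of the coupling caused by the shift `u` does not cancel; boundedness of `g` makes it
  -- grow only linearly.
  set C₄ := κ * |u| * ∑ i, m i * (|C| * D i)
  have hC₄0 : 0 ≤ C₄ := by
    have : 0 ≤ ∑ i, m i * (|C| * D i) := Finset.sum_nonneg fun i _ => by
      have := hm i; have := hD0 i; positivity
    positivity
  set N := c₁ * ∑ i, m i / 4
  have hN0 : 0 ≤ N := by
    have : 0 ≤ ∑ i, m i / 4 := Finset.sum_nonneg fun i _ => by have := hm i; positivity
    positivity
  have hlow : ∀ z : X × Y, c₁ * cX / 2 * ‖z.1‖ ^ 2 - (C₁ + C₄) * ‖z.1‖ - N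
      + κ / c₂ * (cY * ‖z.2‖ ^ 2 - C₂ * ‖z.2‖) ≤ F z z := by
    intro z
    have e1 : F z z = A z.1 z.1 + ℓ z.1 + c₁ * ∑ i, m i * ((a i + p i z.1) ^ 3 * p i z.1)
        - κ * u * ∑ i, m i * (g i (p i z.1) * p i z.1)
        + κ / c₂ * (K z.2 z.2 + ℓ' z.2) := by
      rw [hF]
      have e2 : ∑ i, m i * (g i (p i z.1) * (q i z.2 + u)) * p i z.1
          = ∑ i, m i * (g i (p i z.1) * p i z.1) * q i z.2
            + u * ∑ i, m i * (g i (p i z.1) * p i z.1) := by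
        rw [Finset.mul_sum, ← Finset.sum_add_distrib]
        exact Finset.sum_congr rfl fun i _ => by ring
      have e3 : ∑ i, m i * (a i + p i z.1) ^ 3 * p i z.1
          = ∑ i, m i * ((a i + p i z.1) ^ 3 * p i z.1) :=
        Finset.sum_congr rfl fun i _ => by ring
      rw [e2, e3]
      field_simp
      ring
    have e4 : ∑ i, m i * (p i z.1) ^ 2 / 2 - ∑ i, m i / 4 + ∑ i, m i * a i ^ 3 * p i z.1
        ≤ ∑ i, m i * ((a i + p i z.1) ^ 3 * p i z.1) := by
      rw [← Finset.sum_sub_distrib, ← Finset.sum_add_distrib]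
      refine Finset.sum_le_sum fun i _ => ?_
      have := mul_le_mul_of_nonneg_left (cube_mul_lower_bound (a i) (p i z.1)) (hm i).le
      linarith
    have e5 : |∑ i, m i * (g i (p i z.1) * p i z.1)| ≤ (∑ i, m i * (|C| * D i)) * ‖z.1‖ := by
      rw [Finset.sum_mul]
      refine (Finset.abs_sum_le_sum_abs _ _).trans (Finset.sum_le_sum fun i _ => ?_)
      rw [abs_mul, abs_mul, abs_of_pos (hm i), mul_assoc, mul_assoc]
      exact mul_le_mul_of_nonneg_left (mul_le_mul ((hC i _).trans (le_abs_self C)) (hD i _)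
        (abs_nonneg _) (abs_nonneg _)) (hm i).le
    have e6 : |κ * u * ∑ i, m i * (g i (p i z.1) * p i z.1)| ≤ C₄ * ‖z.1‖ := by
      rw [abs_mul, abs_mul, abs_of_pos hκ]
      simp only [C₄]
      rw [mul_assoc (κ * |u|)]
      gcongr
    have e7 := hC₁ z.1
    simp only [LinearMap.add_apply, LinearMap.smul_apply, LinearMap.sum_apply, smul_eq_mul] at e7
    have e8 := hC₂ z.2
    rw [abs_le] at e6 e7 e8
    have e9 := hcX z.1
    rw [hQ] at e9
    have e10 := hcY z.2
    have e11 : κ / c₂ * (cY * ‖z.2‖ ^ 2 - C₂ * ‖z.2‖) ≤ κ / c₂ * (K z.2 z.2 + ℓ' z.2) := by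
      gcongr
      linarith [e8.1]
    have e12 := hA z.1
    have e13 := mul_le_mul_of_nonneg_left e4 hc₁.le
    have e14 := mul_le_mul_of_nonneg_left e9 hc₁.le
    rw [← Finset.sum_div] at e13
    rw [e1]
    simp only [N]
    linarith [e6.2, e7.1]
  set c := min (c₁ * cX / 2) (κ / c₂ * cY)
  have hc : 0 < c := lt_min (by positivity) (by positivity)
  set S := C₁ + C₄ + κ / c₂ * C₂
  have hS : 0 ≤ S := by positivity
  -- Beyond this radius `c ‖z‖² > S ‖z‖ + N`; the summand 1 gives `‖z‖ ≥ 1`, hence `N ≤ N ‖z‖`.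
  obtain ⟨z, hz⟩ := exists_eq_zero_of_coercive F hFc ((S + N) / c + 1) (by
    intro z hz
    refine lt_of_lt_of_le ?_ (hlow z)
    have h1 : ‖z.1‖ ≤ ‖z‖ := norm_fst_le z
    have h2 : ‖z.2‖ ≤ ‖z‖ := norm_snd_le z
    have h3 : ‖z‖ ^ 2 ≤ ‖z.1‖ ^ 2 + ‖z.2‖ ^ 2 := by
      rcases max_choice ‖z.1‖ ‖z.2‖ with h | h <;> rw [Prod.norm_def, h] <;>
        nlinarith [sq_nonneg ‖z.1‖, sq_nonneg ‖z.2‖]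
    have h4 : c * (‖z.1‖ ^ 2 + ‖z.2‖ ^ 2)
        ≤ c₁ * cX / 2 * ‖z.1‖ ^ 2 + κ / c₂ * cY * ‖z.2‖ ^ 2 := by
      rw [mul_add]
      gcongr
      · exact min_le_left _ _
      · exact min_le_right _ _
    have h5 : (C₁ + C₄) * ‖z.1‖ + κ / c₂ * C₂ * ‖z.2‖ ≤ S * ‖z‖ := by
      rw [add_mul (C₁ + C₄)]
      gcongr
    have h6 : c * ‖z‖ ^ 2 ≤ c * (‖z.1‖ ^ 2 + ‖z.2‖ ^ 2) := by gcongr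
    have h7 : 0 ≤ (S + N) / c := by positivity
    have h8 : S + N + c ≤ c * ‖z‖ := by
      calc S + N + c = c * ((S + N) / c + 1) := by field_simp
        _ ≤ _ := by gcongr
    have h9 : 1 ≤ ‖z‖ := by linarith
    have h10 : (S + N + c) * ‖z‖ ≤ c * ‖z‖ * ‖z‖ := by gcongr
    have h11 : N ≤ N * ‖z‖ := le_mul_of_one_le_right hN0 h9
    nlinarith)
  refine ⟨z.1, z.2, fun χ => ?_, fun χ => ?_⟩
  · have h := hF z (χ, 0)
    rw [hz] at h
    simp only [LinearMap.zero_apply, map_zero, mul_zero, Finset.sum_const_zero, add_zero] at h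
    simp only [← mul_assoc] at h ⊢
    linarith
  · have h := hF z (0, χ)
    rw [hz] at h
    simp only [LinearMap.zero_apply, map_zero, mul_zero, Finset.sum_const_zero, add_zero,
      sub_zero, zero_add] at h
    have h' := (mul_eq_zero.1 h.symm).resolve_left (by positivity)
    simp only [← mul_assoc] at h' ⊢
    linarith

end CoupledSystem
end PhaseFieldFEM

/-! ### Finite element functions through vertex values and cell gradients. -/

noncomputable section
namespace PhaseFieldFEM

variable {d : ℕ} {Ω : Set (Space d)}

/-! ### Geometry of the cells -/

theorem Triangulation.affineSpan_eq_top (T : Triangulation Ω) {s : Finset (Space d)}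
    (hs : s ∈ T.cells) : affineSpan ℝ (s : Set (Space d)) = ⊤ := by
  have h : affineSpan ℝ (Set.range ((↑) : s → Space d)) = ⊤ := by
    rw [(T.indep s hs).affineSpan_eq_top_iff_card_eq_finrank_add_one]
    simp [T.card_eq s hs]
  simpa using h

theorem isCompact_closedSimplex (s : Finset (Space d)) : IsCompact (closedSimplex s) :=
  s.finite_toSet.isCompact_convexHull ℝ

theorem isOpen_openSimplex (s : Finset (Space d)) : IsOpen (openSimplex s) := isOpen_interior

theorem openSimplex_subset_closedSimplex (s : Finset (Space d)) :
    openSimplex s ⊆ closedSimplex s := interior_subset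

theorem Triangulation.openSimplex_nonempty (T : Triangulation Ω) {s : Finset (Space d)}
    (hs : s ∈ T.cells) : (openSimplex s).Nonempty :=
  interior_convexHull_nonempty_iff_affineSpan_eq_top.2 (T.affineSpan_eq_top hs)

theorem Triangulation.closure_openSimplex (T : Triangulation Ω) {s : Finset (Space d)}
    (hs : s ∈ T.cells) : closure (openSimplex s) = closedSimplex s := by
  have h := (convex_convexHull ℝ (s : Set (Space d))).closure_interior_eq_closure_of_nonempty_interior
    (T.openSimplex_nonempty hs)
  exact h.trans (isCompact_closedSimplex s).isClosed.closure_eq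

theorem Triangulation.closedSimplex_subset (T : Triangulation Ω) {s : Finset (Space d)}
    (hs : s ∈ T.cells) : closedSimplex s ⊆ closure Ω := by
  rw [T.closure_eq]
  exact Set.subset_biUnion_of_mem (u := fun s => closedSimplex s) hs

theorem volume_openSimplex_lt_top (s : Finset (Space d)) : volume (openSimplex s) < ⊤ :=
  (measure_mono (openSimplex_subset_closedSimplex s)).trans_lt
    (isCompact_closedSimplex s).measure_lt_top

theorem Triangulation.volume_openSimplex_pos (T : Triangulation Ω) {s : Finset (Space d)}
    (hs : s ∈ T.cells) : 0 < volume.real (openSimplex s) :=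
  ENNReal.toReal_pos ((isOpen_openSimplex s).measure_pos volume (T.openSimplex_nonempty hs)).ne'
    (volume_openSimplex_lt_top s).ne

theorem Triangulation.exists_mem_closedSimplex (T : Triangulation Ω) (x : closure Ω) :
    ∃ s ∈ T.cells, (x : Space d) ∈ closedSimplex s := by
  have hx : (x : Space d) ∈ ⋃ s ∈ T.cells, closedSimplex s := T.closure_eq.subset x.2
  simpa using hx

theorem Triangulation.compactSpace (T : Triangulation Ω) : CompactSpace (closure Ω) := by
  rw [← isCompact_iff_compactSpace, T.closure_eq]
  exact T.cells.isCompact_biUnion fun s _ => isCompact_closedSimplex s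

/-- A common interior point would lie in the interior of the hull of the common vertices, which
would then affinely span the whole space. But a vertex of `s` outside `t` is not in the affine span
of the other vertices of `s`. -/
theorem Triangulation.disjoint_openSimplex (T : Triangulation Ω) {s t : Finset (Space d)}
    (hs : s ∈ T.cells) (ht : t ∈ T.cells) (hst : s ≠ t) :
    Disjoint (openSimplex s) (openSimplex t) := by
  rw [Set.disjoint_iff_inter_eq_empty]
  by_contra hne
  obtain ⟨x, hx⟩ := Set.nonempty_iff_ne_empty.2 hne
  have hint : x ∈ interior (convexHull ℝ ((s : Set (Space d)) ∩ t)) := by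
    refine mem_interior.2 ⟨openSimplex s ∩ openSimplex t, ?_,
      (isOpen_openSimplex s).inter (isOpen_openSimplex t), hx⟩
    exact (Set.inter_subset_inter (openSimplex_subset_closedSimplex s)
      (openSimplex_subset_closedSimplex t)).trans (T.conforming s hs t ht)
  have htop := interior_convexHull_nonempty_iff_affineSpan_eq_top.1 ⟨x, hint⟩
  obtain ⟨p, hps, hpt⟩ : ∃ p ∈ s, p ∉ t := by
    by_contra! h
    exact hst (Finset.eq_of_subset_of_card_le h (by rw [T.card_eq s hs, T.card_eq t ht]))
  refine (T.indep s hs).notMem_affineSpan_sdiff ⟨p, hps⟩ Set.univ ?_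
  have hsub : (s : Set (Space d)) ∩ t ⊆ ((↑) : s → Space d) '' (Set.univ \ {⟨p, hps⟩}) := by
    rintro y ⟨hys, hyt⟩
    refine ⟨⟨y, hys⟩, ⟨trivial, ?_⟩, rfl⟩
    rintro h
    rw [Set.mem_singleton_iff, Subtype.mk.injEq] at h
    exact hpt (h ▸ hyt)
  have := affineSpan_mono ℝ hsub
  rw [htop] at this
  exact this (AffineSubspace.mem_top ℝ _ _)

/-- Frontiers of convex sets are null, so `Ω` agrees almost everywhere with the disjoint union of
the open cells. -/
theorem Triangulation.integral_eq_sum (T : Triangulation Ω) (f : Space d → ℝ)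
    (hf : ∀ s ∈ T.cells, IntegrableOn f (openSimplex s)) :
    ∫ x in Ω, f x = ∑ s : T.cells, ∫ x in openSimplex s.1, f x := by
  have hae : (Ω : Set (Space d)) =ᵐ[volume] ⋃ s ∈ T.cells, openSimplex s := by
    have hnull : volume (⋃ s ∈ T.cells, frontier (closedSimplex s)) = 0 :=
      (measure_biUnion_null_iff T.cells.countable_toSet).2 fun s _ =>
        (convex_convexHull ℝ (s : Set (Space d))).addHaar_frontier volume
    refine Filter.EventuallyLE.antisymm ?_ ?_
    · rw [ae_le_set]
      refine measure_mono_null ?_ hnull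
      rintro x ⟨hx, hxn⟩
      obtain ⟨s, hs, hxs⟩ := T.exists_mem_closedSimplex ⟨x, subset_closure hx⟩
      simp only [Set.mem_iUnion, not_exists] at hxn ⊢
      refine ⟨s, hs, subset_closure hxs, hxn s hs⟩
    · exact LE.le.eventuallyLE (Set.iUnion₂_subset T.openSimplex_subset)
  rw [setIntegral_congr_set hae, integral_biUnion_finset T.cells
    (fun s _ => (isOpen_openSimplex s).measurableSet)
    (fun s hs t ht hst => T.disjoint_openSimplex hs ht hst) hf]
  exact (Finset.sum_coe_sort T.cells fun s => ∫ x in openSimplex s, f x).symm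

/-! ### Vertices and mass lumping -/

/-- A cell together with one of its vertices. -/
abbrev Triangulation.CellVertex (T : Triangulation Ω) : Type :=
  Σ s : T.cells, (s.1 : Finset (Space d))

/-- The vertex of a pair of a cell and a vertex, as a point of `closure Ω`. -/
def Triangulation.vertex (T : Triangulation Ω) (i : T.CellVertex) : closure Ω :=
  ⟨i.2.1, T.closedSimplex_subset i.1.2 (subset_convexHull ℝ _ i.2.2)⟩

/-- The quadrature weights. -/
def Triangulation.weight (T : Triangulation Ω) (i : T.CellVertex) : ℝ :=
  volume.real (openSimplex i.1.1) / (d + 1)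

theorem Triangulation.weight_pos (T : Triangulation Ω) (i : T.CellVertex) : 0 < T.weight i :=
  div_pos (T.volume_openSimplex_pos i.1.2) (by positivity)

theorem extZero_coe (χ : C(closure Ω, ℝ)) (x : closure Ω) : extZero χ x = χ x :=
  Subtype.val_injective.extend_apply χ 0 x

theorem continuousOn_extZero (χ : C(closure Ω, ℝ)) : ContinuousOn (extZero χ) (closure Ω) := by
  rw [continuousOn_iff_continuous_domRestrict]
  have : (closure Ω).domRestrict (extZero χ) = χ := by
    ext x
    exact extZero_coe χ x
  rw [this]
  exact χ.continuous

theorem Triangulation.tendsto_extZero (T : Triangulation Ω) (χ : C(closure Ω, ℝ))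
    (i : T.CellVertex) :
    Filter.Tendsto (extZero χ) (𝓝[openSimplex i.1.1] (i.2.1 : Space d)) (𝓝 (χ (T.vertex i))) := by
  have h := continuousOn_extZero χ _ (T.vertex i).2
  rw [ContinuousWithinAt, extZero_coe] at h
  exact h.mono_left (nhdsWithin_mono _
    ((openSimplex_subset_closedSimplex _).trans (T.closedSimplex_subset i.1.2)))

/-- Each vertex lies in the closure of its open cell, so the limit in `lumped` is a genuine one. `F`
is indexed by pairs because limits from different cells at a shared vertex may differ. -/
theorem Triangulation.lumped_eq (T : Triangulation Ω) (f : Space d → ℝ) (F : T.CellVertex → ℝ)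
    (hF : ∀ i : T.CellVertex,
      Filter.Tendsto f (𝓝[openSimplex i.1.1] (i.2.1 : Space d)) (𝓝 (F i)))
    (χ : C(closure Ω, ℝ)) :
    lumped T f (extZero χ) = ∑ i, T.weight i * (F i * χ (T.vertex i)) := by
  rw [lumped, Fintype.sum_sigma, ← Finset.sum_coe_sort]
  refine Finset.sum_congr rfl fun s _ => ?_
  rw [← Finset.sum_coe_sort s.1, Finset.mul_sum]
  refine Finset.sum_congr rfl fun p _ => ?_
  have : (𝓝[openSimplex s.1] (p : Space d)).NeBot := by
    rw [← mem_closure_iff_nhdsWithin_neBot, T.closure_openSimplex s.2]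
    exact subset_convexHull ℝ _ p.2
  rw [((hF ⟨s, p⟩).mul (T.tendsto_extZero χ ⟨s, p⟩)).limUnder_eq]
  rfl

/-! ### The finite element space -/

/-- Evaluation at a vertex. -/
def Triangulation.vertexEval (T : Triangulation Ω) (i : T.CellVertex) : feSpace T →ₗ[ℝ] ℝ where
  toFun χ := (χ : C(closure Ω, ℝ)) (T.vertex i)
  map_add' _ _ := rfl
  map_smul' _ _ := rfl

theorem Triangulation.vertexEval_apply (T : Triangulation Ω) (i : T.CellVertex)
    (χ : feSpace T) : T.vertexEval i χ = (χ : C(closure Ω, ℝ)) (T.vertex i) := rfl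

theorem Triangulation.eq_zero_of_vertexEval (T : Triangulation Ω) (χ : feSpace T)
    (h : ∀ i, T.vertexEval i χ = 0) : χ = 0 := by
  ext x
  obtain ⟨s, hs, hx⟩ := T.exists_mem_closedSimplex x
  obtain ⟨A, hA⟩ := χ.2 s hs
  rw [hA x hx]
  have hc : Convex ℝ {y | A y = 0} := (convex_singleton (𝕜 := ℝ) (0 : ℝ)).affine_preimage A
  refine convexHull_min (fun p hp => ?_) hc hx
  have h1 := h ⟨⟨s, hs⟩, ⟨p, hp⟩⟩
  rw [T.vertexEval_apply, hA _ (subset_convexHull ℝ _ hp)] at h1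
  exact h1

theorem Triangulation.finiteDimensional (T : Triangulation Ω) :
    FiniteDimensional ℝ (feSpace T) :=
  FiniteDimensional.of_injective (LinearMap.pi T.vertexEval) <|
    (injective_iff_map_eq_zero _).2 fun χ hχ =>
      T.eq_zero_of_vertexEval χ fun i => congrFun hχ i

theorem const_mem_feSpace (T : Triangulation Ω) (c : ℝ) :
    ContinuousMap.const (closure Ω) c ∈ feSpace T :=
  fun _ _ => ⟨AffineMap.const ℝ (Space d) c, fun _ _ => rfl⟩

/-- Constants as finite element functions. -/
def Triangulation.const (T : Triangulation Ω) (c : ℝ) : feSpace T :=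
  ⟨ContinuousMap.const _ c, const_mem_feSpace T c⟩

theorem Triangulation.vertexEval_const (T : Triangulation Ω) (i : T.CellVertex) (c : ℝ) :
    T.vertexEval i (T.const c) = c := rfl

/-! ### Gradients -/

theorem hasGradientAt_extZero {χ : C(closure Ω, ℝ)} (T : Triangulation Ω)
    {s : Finset (Space d)} (hs : s ∈ T.cells) (A : Space d →ᵃ[ℝ] ℝ)
    (hA : ∀ x : closure Ω, (x : Space d) ∈ closedSimplex s → χ x = A x) {x : Space d}
    (hx : x ∈ openSimplex s) :
    HasGradientAt (extZero χ)
      ((InnerProductSpace.toDual ℝ (Space d)).symm (LinearMap.toContinuousLinearMap A.linear))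
      x := by
  rw [hasGradientAt_iff_hasFDerivAt, LinearIsometryEquiv.apply_symm_apply]
  have h1 : HasFDerivAt (fun y => A.linear y + A 0)
      (LinearMap.toContinuousLinearMap A.linear) x :=
    (LinearMap.toContinuousLinearMap A.linear).hasFDerivAt.add_const _
  refine h1.congr_of_eventuallyEq ?_
  filter_upwards [(isOpen_openSimplex s).mem_nhds hx] with y hy
  have hy' := openSimplex_subset_closedSimplex s hy
  have h2 := extZero_coe χ ⟨y, T.closedSimplex_subset hs hy'⟩
  rw [hA _ hy'] at h2
  rw [h2]
  exact congrFun A.decomp y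

/-- The constant gradient on a cell. -/
def Triangulation.cellGrad (T : Triangulation Ω) (s : T.cells) : feSpace T →ₗ[ℝ] Space d where
  toFun χ := grad χ.1 (T.openSimplex_nonempty s.2).some
  map_add' χ ξ := by
    obtain ⟨A, hA⟩ := χ.2 s s.2
    obtain ⟨B, hB⟩ := ξ.2 s s.2
    have hx := (T.openSimplex_nonempty s.2).some_mem
    have h := (hasGradientAt_extZero (χ := (χ + ξ : feSpace T).1) T s.2 (A + B)
      (fun x hx => by simp [hA x hx, hB x hx]) hx).gradient
    rw [grad, grad, grad, h, (hasGradientAt_extZero T s.2 A hA hx).gradient,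
      (hasGradientAt_extZero T s.2 B hB hx).gradient, ← map_add]
    rfl
  map_smul' c χ := by
    obtain ⟨A, hA⟩ := χ.2 s s.2
    have hx := (T.openSimplex_nonempty s.2).some_mem
    have h := (hasGradientAt_extZero (χ := (c • χ : feSpace T).1) T s.2 (c • A)
      (fun x hx => by simp [hA x hx]) hx).gradient
    rw [grad, grad, h, (hasGradientAt_extZero T s.2 A hA hx).gradient]
    simp only [RingHom.id_apply]
    rw [AffineMap.smul_linear, map_smul]
    simp

theorem Triangulation.grad_eq_cellGrad (T : Triangulation Ω) (s : T.cells) (χ : feSpace T)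
    {x : Space d} (hx : x ∈ openSimplex s.1) : grad χ.1 x = T.cellGrad s χ := by
  obtain ⟨A, hA⟩ := χ.2 s s.2
  change grad χ.1 x = grad χ.1 _
  rw [grad, grad, (hasGradientAt_extZero T s.2 A hA hx).gradient,
    (hasGradientAt_extZero T s.2 A hA (T.openSimplex_nonempty s.2).some_mem).gradient]

theorem Triangulation.exists_eq_const_on_cell (T : Triangulation Ω) (s : T.cells)
    (χ : feSpace T) (h : T.cellGrad s χ = 0) :
    ∃ c, ∀ x : closure Ω, (x : Space d) ∈ closedSimplex s.1 → (χ : C(closure Ω, ℝ)) x = c := by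
  obtain ⟨A, hA⟩ := χ.2 s s.2
  refine ⟨A 0, fun x hx => ?_⟩
  change grad χ.1 _ = 0 at h
  rw [grad, (hasGradientAt_extZero T s.2 A hA (T.openSimplex_nonempty s.2).some_mem).gradient,
    map_eq_zero_iff _ (LinearIsometryEquiv.injective _)] at h
  have h1 : A.linear = 0 := by simpa using h
  rw [hA x hx, A.decomp]
  simp [h1]

theorem Triangulation.cellGrad_const (T : Triangulation Ω) (s : T.cells) (c : ℝ) :
    T.cellGrad s (T.const c) = 0 := by
  have h := (hasGradientAt_extZero (χ := (T.const c).1) T s.2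
    (AffineMap.const ℝ (Space d) c) (fun x hx => rfl)
    (T.openSimplex_nonempty s.2).some_mem).gradient
  refine h.trans ?_
  rw [map_eq_zero_iff _ (LinearIsometryEquiv.injective _)]
  ext
  simp

/-- The function takes finitely many values, one per cell, and a continuous real function on a
connected set with finite range is constant. No chain of neighbouring cells is needed. -/
theorem Triangulation.eq_const_of_cellGrad (T : Triangulation Ω) (hΩ : IsConnected Ω)
    (χ : feSpace T) (h : ∀ s, T.cellGrad s χ = 0) : ∃ c, χ = T.const c := by
  choose c hc using fun s => T.exists_eq_const_on_cell s χ (h s)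
  have hfin : (Set.range (χ : C(closure Ω, ℝ))).Finite := by
    refine (Set.finite_range c).subset ?_
    rintro _ ⟨x, rfl⟩
    obtain ⟨s, hs, hx⟩ := T.exists_mem_closedSimplex x
    exact ⟨⟨s, hs⟩, (hc ⟨s, hs⟩ x hx).symm⟩
  have : ConnectedSpace (closure Ω) := isConnected_iff_connectedSpace.1 hΩ.closure
  have hconn : IsPreconnected (Set.range (χ : C(closure Ω, ℝ))) :=
    isPreconnected_range (map_continuous _)
  have hsub : (Set.range (χ : C(closure Ω, ℝ))).Subsingleton := by
    rw [← Set.not_nontrivial_iff]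
    intro hnt
    exact hconn.infinite_of_nontrivial hnt hfin
  obtain ⟨x₀, hx₀⟩ := hΩ.nonempty
  refine ⟨(χ : C(closure Ω, ℝ)) ⟨x₀, subset_closure hx₀⟩, ?_⟩
  ext x
  exact hsub ⟨x, rfl⟩ ⟨_, rfl⟩

/-! ### Stiffness forms -/

/-- The bilinear form `∑_σ k_σ ∇u|_σ · ∇v|_σ`, with linear maps `k_σ`. -/
def Triangulation.stiffness (T : Triangulation Ω) (k : T.cells → Space d →ₗ[ℝ] Space d) :
    feSpace T →ₗ[ℝ] feSpace T →ₗ[ℝ] ℝ :=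
  ∑ s, (innerₗ (Space d)).compl₁₂ (k s ∘ₗ T.cellGrad s) (T.cellGrad s)

theorem Triangulation.stiffness_apply (T : Triangulation Ω)
    (k : T.cells → Space d →ₗ[ℝ] Space d) (u v : feSpace T) :
    T.stiffness k u v = ∑ s, inner ℝ (k s (T.cellGrad s u)) (T.cellGrad s v) := by
  simp [Triangulation.stiffness, LinearMap.sum_apply]

theorem Triangulation.stiffness_self_nonneg (T : Triangulation Ω)
    (k : T.cells → Space d →ₗ[ℝ] Space d) (hk : ∀ s v, 0 ≤ inner ℝ (k s v) v) (u : feSpace T) :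
    0 ≤ T.stiffness k u u := by
  rw [T.stiffness_apply]
  exact Finset.sum_nonneg fun s _ => hk s _

theorem Triangulation.stiffness_const_left (T : Triangulation Ω)
    (k : T.cells → Space d →ₗ[ℝ] Space d) (c : ℝ) (u : feSpace T) :
    T.stiffness k (T.const c) u = 0 := by
  simp [T.stiffness_apply, T.cellGrad_const]

theorem Triangulation.stiffness_const_right (T : Triangulation Ω)
    (k : T.cells → Space d →ₗ[ℝ] Space d) (c : ℝ) (u : feSpace T) :
    T.stiffness k u (T.const c) = 0 := by
  simp [T.stiffness_apply, T.cellGrad_const]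

theorem Triangulation.eq_const_of_stiffness (T : Triangulation Ω) (hΩ : IsConnected Ω)
    (k : T.cells → ℝ) (hk : ∀ s, 0 < k s) (u : feSpace T)
    (hu : T.stiffness (fun s => k s • LinearMap.id) u u ≤ 0) : ∃ c, u = T.const c := by
  refine T.eq_const_of_cellGrad hΩ u fun s => ?_
  rw [T.stiffness_apply] at hu
  have hnn : ∀ s ∈ (Finset.univ : Finset T.cells),
      0 ≤ inner ℝ ((k s • LinearMap.id : Space d →ₗ[ℝ] Space d) (T.cellGrad s u))
        (T.cellGrad s u) := by
    intro s _
    simp only [LinearMap.smul_apply, LinearMap.id_apply, inner_smul_left]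
    exact mul_nonneg (hk s).le real_inner_self_nonneg
  have h0 := (Finset.sum_eq_zero_iff_of_nonneg hnn).1
    (le_antisymm hu (Finset.sum_nonneg hnn)) s (Finset.mem_univ s)
  simp only [LinearMap.smul_apply, LinearMap.id_apply, inner_smul_left] at h0
  exact inner_self_eq_zero.1 ((mul_eq_zero.1 h0).resolve_left (by simpa using (hk s).ne'))

theorem Triangulation.integral_weighted_grad (T : Triangulation Ω) (b : C(closure Ω, ℝ))
    (u v : feSpace T) :
    ∫ x in Ω, inner ℝ (extZero b x • grad u.1 x) (grad v.1 x)
      = T.stiffness (fun s => (∫ x in openSimplex s.1, extZero b x) • LinearMap.id) u v := by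
  have hcongr : ∀ s : T.cells, Set.EqOn (fun x => inner ℝ (extZero b x • grad u.1 x) (grad v.1 x))
      (fun x => extZero b x * inner ℝ (T.cellGrad s u) (T.cellGrad s v)) (openSimplex s.1) := by
    intro s x hx
    simp only [T.grad_eq_cellGrad s u hx, T.grad_eq_cellGrad s v hx, inner_smul_left]
    rfl
  have hint : ∀ s ∈ T.cells, IntegrableOn (extZero b) (openSimplex s) := fun s hs =>
    (((continuousOn_extZero b).mono (T.closedSimplex_subset hs)).integrableOn_compact
      (isCompact_closedSimplex s)).mono_set (openSimplex_subset_closedSimplex s)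
  rw [T.integral_eq_sum _ fun s hs => (IntegrableOn.congr_fun ((hint s hs).mul_const _)
    (hcongr ⟨s, hs⟩).symm (isOpen_openSimplex s).measurableSet), T.stiffness_apply]
  refine Finset.sum_congr rfl fun s _ => ?_
  rw [setIntegral_congr_fun (isOpen_openSimplex s.1).measurableSet (hcongr s),
    integral_mul_const]
  simp [inner_smul_left]

theorem Triangulation.integral_matrix_grad (T : Triangulation Ω)
    (B : Space d → Space d → Matrix (Fin d) (Fin d) ℝ) (w u v : feSpace T) :
    ∫ x in Ω, inner ℝ
        (WithLp.toLp 2 (B (grad w.1 x) (grad u.1 x) *ᵥ (grad u.1 x).ofLp)) (grad v.1 x)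
      = T.stiffness (fun s => volume.real (openSimplex s.1) •
          Matrix.toEuclideanLin (B (T.cellGrad s w) (T.cellGrad s u))) u v := by
  have hcongr : ∀ s : T.cells, Set.EqOn (fun x => inner ℝ
      (WithLp.toLp 2 (B (grad w.1 x) (grad u.1 x) *ᵥ (grad u.1 x).ofLp)) (grad v.1 x))
      (fun x => inner ℝ (Matrix.toEuclideanLin (B (T.cellGrad s w) (T.cellGrad s u))
        (T.cellGrad s u)) (T.cellGrad s v)) (openSimplex s.1) := by
    intro s x hx
    simp only [T.grad_eq_cellGrad s u hx, T.grad_eq_cellGrad s v hx, T.grad_eq_cellGrad s w hx]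
    rfl
  rw [T.integral_eq_sum _ fun s hs => (IntegrableOn.congr_fun
    (integrableOn_const (volume_openSimplex_lt_top s).ne)
    (hcongr ⟨s, hs⟩).symm (isOpen_openSimplex s).measurableSet), T.stiffness_apply]
  refine Finset.sum_congr rfl fun s _ => ?_
  rw [setIntegral_congr_fun (isOpen_openSimplex s.1).measurableSet (hcongr s)]
  simp [inner_smul_left]

/-- On a cell the interpolant is affine with positive vertex values, hence positive on the convex
hull. -/
theorem Triangulation.integral_interpolate_pos (T : Triangulation Ω) (η : closure Ω → ℝ)
    (hη : ∀ x, 0 < η x) (s : T.cells) :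
    0 < ∫ x in openSimplex s.1, extZero (interpolate T η) x := by
  obtain ⟨hmem, hnodes⟩ := (exists_nodalInterpolant T η).choose_spec
  obtain ⟨A, hA⟩ := hmem s s.2
  have hpos : ∀ x ∈ closedSimplex s.1, 0 < A x := by
    have hc : Convex ℝ {y | 0 < A y} := (convex_Ioi (𝕜 := ℝ) (0 : ℝ)).affine_preimage A
    refine convexHull_min (fun p hp => ?_) hc
    have hpm := subset_convexHull ℝ (s.1 : Set (Space d)) hp
    have h1 := hnodes ⟨p, T.closedSimplex_subset s.2 hpm⟩ ⟨s, s.2, hp⟩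
    rw [hA ⟨p, T.closedSimplex_subset s.2 hpm⟩ hpm] at h1
    exact (hη _).trans_eq h1.symm
  have heq : Set.EqOn (extZero (interpolate T η)) A (openSimplex s.1) := fun x hx => by
    have hx' := openSimplex_subset_closedSimplex _ hx
    rw [← hA ⟨x, T.closedSimplex_subset s.2 hx'⟩ hx']
    exact extZero_coe _ ⟨x, T.closedSimplex_subset s.2 hx'⟩
  have hAc : Continuous A := A.continuous_of_finiteDimensional
  rw [setIntegral_congr_fun (isOpen_openSimplex s.1).measurableSet heq]
  rw [setIntegral_pos_iff_support_of_nonneg_ae]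
  · have : openSimplex s.1 ⊆ Function.support A ∩ openSimplex s.1 := fun x hx =>
      ⟨(hpos x (openSimplex_subset_closedSimplex _ hx)).ne', hx⟩
    exact ((isOpen_openSimplex s.1).measure_pos volume (T.openSimplex_nonempty s.2)).trans_le
      (measure_mono this)
  · exact (ae_restrict_iff' (isOpen_openSimplex s.1).measurableSet).2
      (Filter.Eventually.of_forall fun x hx =>
        (hpos x (openSimplex_subset_closedSimplex _ hx)).le)
  · exact (hAc.continuousOn.integrableOn_compact (isCompact_closedSimplex s.1)).mono_set
      (openSimplex_subset_closedSimplex _)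

end PhaseFieldFEM
end

/-! ### Coefficients, and the scheme as two linear residuals in the test function. -/

noncomputable section
namespace PhaseFieldFEM

variable {d L : ℕ} {Ω : Set (Space d)}

/-! ### The coefficients -/

/-- Writing the truncation as a clamp yields its continuity and its bound. -/
theorem Splitting.rhoPlusCut_eq (S : Splitting) {m : ℝ} (hm : 0 ≤ m) (s : ℝ) :
    S.rhoPlusCut m s = S.rhoPlus (max (-m) (min m s)) := by
  unfold Splitting.rhoPlusCut
  split_ifs with h1 h2
  · rw [min_eq_left h1, max_eq_right (by linarith)]
  · rw [min_eq_right (not_le.1 h1).le, max_eq_left h2]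
  · rw [min_eq_right (not_le.1 h1).le, max_eq_right (not_le.1 h2).le]

theorem Splitting.continuous_rhoPlusCut (S : Splitting) {m : ℝ} (hm : 0 ≤ m) :
    Continuous (S.rhoPlusCut m) := by
  have h : S.rhoPlusCut m = fun s => S.rhoPlus (max (-m) (min m s)) :=
    funext (S.rhoPlusCut_eq hm)
  rw [h]
  cases S <;> simp only [Splitting.rhoPlus] <;> fun_prop

theorem Splitting.abs_rhoPlusCut_le (S : Splitting) {m : ℝ} (hm : 0 ≤ m) (s : ℝ) :
    |S.rhoPlusCut m s| ≤ 3 / 2 * m := by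
  rw [S.rhoPlusCut_eq hm]
  have h1 : |max (-m) (min m s)| ≤ m :=
    abs_le.2 ⟨le_max_left _ _, max_le (by linarith) (min_le_left _ _)⟩
  cases S <;> simp only [Splitting.rhoPlus, abs_mul, abs_neg, abs_zero]
  · positivity
  · positivity
  · rw [abs_of_pos (by norm_num : (0 : ℝ) < 3 / 2)]
    gcongr
  · positivity
  · rw [abs_of_pos (by norm_num : (0 : ℝ) < 3 / 2)]
    gcongr

theorem Splitting.continuous_rhoMinus (S : Splitting) : Continuous S.rhoMinus := by
  unfold Splitting.rhoMinus
  cases S <;> simp only [Splitting.rho, Splitting.rhoPlus] <;> fun_prop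

theorem Splitting.continuous_rhoHat (S : Splitting) {m : ℝ} (hm : 0 ≤ m) :
    Continuous fun z : ℝ × ℝ => S.rhoHat m z.1 z.2 :=
  (S.continuous_rhoMinus.comp continuous_fst).add
    ((S.continuous_rhoPlusCut hm).comp continuous_snd)

/-- For these splittings the coupling coefficient does not see the new phase field, so the coupling
is linear in the unknowns. -/
theorem Splitting.rhoHat_eq_rho {S : Splitting} (hS : S = .i ∨ S = .ii ∨ S = .iiPos)
    (m s t : ℝ) : S.rhoHat m s t = S.rho s := by
  rcases hS with rfl | rfl | rfl <;>
    simp [Splitting.rhoHat, Splitting.rhoMinus, Splitting.rhoPlusCut, Splitting.rhoPlus]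

theorem Parameters.bTilde_pos (P : Parameters) (s : ℝ) : 0 < P.bTilde s := by
  have h1 := P.Kplus_pos
  have h2 := P.Kminus_pos
  unfold Parameters.bTilde Parameters.b
  split_ifs with h3 h4
  · linarith
  · linarith
  · rw [not_le] at h3 h4
    have := mul_pos (by linarith : 0 < 1 / 2 * (1 + s)) h1
    have := mul_pos (by linarith : 0 < 1 / 2 * (1 - s)) h2
    linarith

theorem cPot_quarticPotential_pos : 0 < cPot quarticPotential := by
  unfold cPot
  have hc : Continuous fun s : ℝ => Real.sqrt (2 * quarticPotential s) := by
    unfold quarticPotential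
    fun_prop
  refine intervalIntegral.intervalIntegral_pos_of_pos_on (hc.intervalIntegrable _ _) ?_
    (by norm_num)
  rintro s ⟨h1, h2⟩
  refine Real.sqrt_pos.2 ?_
  have h3 : 0 < (1 - s) * (1 + s) := mul_pos (by linarith) (by linarith)
  have h4 : s ^ 2 - 1 ≠ 0 := by nlinarith
  unfold quarticPotential
  positivity

theorem gamma_nonneg (r : ℝ) (G : Fin L → Matrix (Fin d) (Fin d) ℝ) (p : Space d) :
    0 ≤ gamma r G p :=
  Real.rpow_nonneg (Finset.sum_nonneg fun _ _ => Real.rpow_nonneg (Real.sqrt_nonneg _) _) _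

theorem kineticCoeff_nonneg {G : Fin L → Matrix (Fin d) (Fin d) ℝ} {β : Space d → ℝ}
    (hβ : IsMobility β) {μ₀ : ℝ} (hμ₀ : IsKineticValueAtZero (gamma 1 G) β μ₀) (p : Space d) :
    0 ≤ kineticCoeff (gamma 1 G) β μ₀ p := by
  unfold kineticCoeff
  split_ifs with h
  · obtain ⟨⟨q, -, hq⟩, -⟩ := hμ₀
    exact (div_nonneg (gamma_nonneg _ _ _) (hβ.nonneg q)).trans hq
  · exact div_nonneg (gamma_nonneg _ _ _) (hβ.nonneg p)

/-- For `r = 1` the ratios carry the exponent 0, so the second argument drops out and the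
anisotropic term is linear in the new gradient. -/
theorem anisoB_one (G : Fin L → Matrix (Fin d) (Fin d) ℝ) (q p : Space d) :
    anisoB 1 G q p = anisoB 1 G q 0 := by
  simp [anisoB]

theorem inner_toEuclideanLin_nonneg {B : Matrix (Fin d) (Fin d) ℝ} (hB : B.PosSemidef)
    (v : Space d) : 0 ≤ inner ℝ (Matrix.toEuclideanLin B v) v := by
  have h := hB.dotProduct_mulVec_nonneg v.ofLp
  simpa [Matrix.toLpLin_apply, PiLp.inner_apply, dotProduct, mul_comm] using h

theorem posSemidef_anisoB {G : Fin L → Matrix (Fin d) (Fin d) ℝ} (hG : ∀ l, (G l).PosDef)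
    (q p : Space d) : (anisoB 1 G q p).PosSemidef := by
  unfold anisoB
  have hsum : ∀ c : Fin L → ℝ, (∀ l, 0 ≤ c l) → (∑ l, c l • G l).PosSemidef := fun c hc =>
    Matrix.posSemidef_sum _ fun l _ => (hG l).posSemidef.smul (hc l)
  split_ifs with h
  · exact (hsum _ fun l => by simp).smul (by positivity)
  · exact (hsum _ fun l => by simp [gammaL]).smul (gamma_nonneg _ _ _)

/-! ### The scheme in terms of vertex values and cell gradients -/

/-- The form `∑_i c_i u(p_i) v(p_i)`. -/
def Triangulation.mass (T : Triangulation Ω) (c : T.CellVertex → ℝ) :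
    feSpace T →ₗ[ℝ] feSpace T →ₗ[ℝ] ℝ :=
  ∑ i, c i • (LinearMap.mul ℝ ℝ).compl₁₂ (T.vertexEval i) (T.vertexEval i)

theorem Triangulation.mass_apply (T : Triangulation Ω) (c : T.CellVertex → ℝ)
    (u v : feSpace T) :
    T.mass c u v = ∑ i, c i * (T.vertexEval i u * T.vertexEval i v) := by
  simp [Triangulation.mass, LinearMap.sum_apply]

/-- The integrals of the interpolated heat conductivity over the cells. -/
def conductivity (T : Triangulation Ω) (P : Parameters) (Φold : feSpace T) (s : T.cells) : ℝ :=
  ∫ x in openSimplex s.1, extZero (interpolate T fun y => P.bTilde (Φold.1 y)) x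

theorem conductivity_pos (T : Triangulation Ω) (P : Parameters) (Φold : feSpace T)
    (s : T.cells) : 0 < conductivity T P Φold s :=
  T.integral_interpolate_pos _ (fun _ => P.bTilde_pos _) s

/-- The linear form in `χ` on the left hand side of the discrete heat equation. -/
def heatResidual (T : Triangulation Ω) (P : Parameters) (S : Splitting) (Φold : feSpace T)
    (Wold : C(closure Ω, ℝ)) (Φ W : feSpace T) : feSpace T →ₗ[ℝ] ℝ :=
  ∑ i, (T.weight i * (P.ϑ * ((T.vertexEval i W - Wold (T.vertex i)) / P.τ)
      + P.lam * (S.rhoHat P.m (T.vertexEval i Φold) (T.vertexEval i Φ) *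
        ((T.vertexEval i Φ - T.vertexEval i Φold) / P.τ)))) • T.vertexEval i
    + T.stiffness (fun s => conductivity T P Φold s • LinearMap.id) W

/-- The anisotropic stiffness form. -/
def anisoStiffness (T : Triangulation Ω) (G : Fin L → Matrix (Fin d) (Fin d) ℝ)
    (Φold : feSpace T) : feSpace T →ₗ[ℝ] feSpace T →ₗ[ℝ] ℝ :=
  T.stiffness fun s => volume.real (openSimplex s.1) •
    Matrix.toEuclideanLin (anisoB 1 G (T.cellGrad s Φold) 0)

theorem anisoStiffness_self_nonneg (T : Triangulation Ω)
    {G : Fin L → Matrix (Fin d) (Fin d) ℝ} (hG : ∀ l, (G l).PosDef) (Φold u : feSpace T) :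
    0 ≤ anisoStiffness T G Φold u u := by
  refine T.stiffness_self_nonneg _ (fun s v => ?_) u
  rw [LinearMap.smul_apply, inner_smul_left]
  exact mul_nonneg (by simp) (inner_toEuclideanLin_nonneg (posSemidef_anisoB hG _ _) v)

/-- The difference of the two sides of the discrete Allen--Cahn equation, as a linear form
in `χ`. -/
def allenCahnResidual (T : Triangulation Ω) (G : Fin L → Matrix (Fin d) (Fin d) ℝ)
    (β : Space d → ℝ) (μ₀ : ℝ) (P : Parameters) (S : Splitting) (Φold Φ W : feSpace T) :
    feSpace T →ₗ[ℝ] ℝ :=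
  ∑ i, (T.weight i * (P.ε * (P.ρ / P.α) *
        (kineticCoeff (gamma 1 G) β μ₀ (T.cellGrad i.1 Φold) *
          ((T.vertexEval i Φ - T.vertexEval i Φold) / P.τ))
      + P.ε⁻¹ * phiPlus (T.vertexEval i Φ)
      - (cPot quarticPotential * (P.a / P.α) *
          S.rhoHat P.m (T.vertexEval i Φold) (T.vertexEval i Φ) * T.vertexEval i W
        - P.ε⁻¹ * phiMinus (T.vertexEval i Φold)))) • T.vertexEval i
    + P.ε • anisoStiffness T G Φold Φ

theorem heatEquation_iff (T : Triangulation Ω) (ΓD : Set (Space d)) (P : Parameters)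
    (S : Splitting) (Φold : feSpace T) (Wold : C(closure Ω, ℝ)) (Φ W : feSpace T) :
    HeatEquation T ΓD P S Φold Wold Φ W ↔ ∀ χ : feSpace T,
      (∀ x : closure Ω, (x : Space d) ∈ ΓD → χ.1 x = 0) →
        heatResidual T P S Φold Wold Φ W χ = 0 := by
  have key : ∀ χ : feSpace T, P.ϑ * lumped T
        (fun x => (extZero W.1 x - extZero Wold x) / P.τ) (extZero χ.1)
      + P.lam * lumped T
          (fun x => S.rhoHat P.m (extZero Φold.1 x) (extZero Φ.1 x) *
            ((extZero Φ.1 x - extZero Φold.1 x) / P.τ)) (extZero χ.1)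
      + (∫ x in Ω, inner ℝ
          (extZero (interpolate T (fun y => P.bTilde (Φold.1 y))) x • grad W.1 x) (grad χ.1 x))
      = heatResidual T P S Φold Wold Φ W χ := by
    intro χ
    rw [T.lumped_eq _ (fun i => (T.vertexEval i W - Wold (T.vertex i)) / P.τ),
      T.lumped_eq _ (fun i => S.rhoHat P.m (T.vertexEval i Φold) (T.vertexEval i Φ) *
        ((T.vertexEval i Φ - T.vertexEval i Φold) / P.τ)), T.integral_weighted_grad]
    · simp only [heatResidual, LinearMap.add_apply, LinearMap.sum_apply, LinearMap.smul_apply,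
        smul_eq_mul]
      rw [Finset.mul_sum, Finset.mul_sum, ← Finset.sum_add_distrib]
      congr 1
      refine Finset.sum_congr rfl fun i _ => ?_
      simp only [T.vertexEval_apply]
      ring
    · intro i
      have h0 := T.tendsto_extZero Φold.1 i
      have h1 := T.tendsto_extZero Φ.1 i
      exact (((S.continuous_rhoHat (by linarith [P.two_le_m])).tendsto _).comp
        (h0.prodMk_nhds h1)).mul ((h1.sub h0).div_const _)
    · intro i
      exact ((T.tendsto_extZero W.1 i).sub (T.tendsto_extZero Wold i)).div_const _
  constructor
  · intro h χ hχ
    rw [← key]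
    exact h χ ⟨χ.2, hχ⟩
  · rintro h χ ⟨hχ, hχ0⟩
    have := h ⟨χ, hχ⟩ hχ0
    rw [← key] at this
    exact this

theorem allenCahnEquation_iff (T : Triangulation Ω) (G : Fin L → Matrix (Fin d) (Fin d) ℝ)
    (β : Space d → ℝ) (μ₀ : ℝ) (P : Parameters) (S : Splitting) (Φold Φ W : feSpace T) :
    AllenCahnEquation T 1 G β μ₀ P S Φold Φ W ↔
      allenCahnResidual T G β μ₀ P S Φold Φ W = 0 := by
  have key : ∀ χ : feSpace T, P.ε * (P.ρ / P.α) * lumped T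
        (fun x => kineticCoeff (gamma 1 G) β μ₀ (grad Φold.1 x) *
          ((extZero Φ.1 x - extZero Φold.1 x) / P.τ))
        (extZero χ.1)
      + P.ε * (∫ x in Ω, inner ℝ
        (WithLp.toLp 2 (anisoB 1 G (grad Φold.1 x) (grad Φ.1 x) *ᵥ (grad Φ.1 x).ofLp))
          (grad χ.1 x))
      + P.ε⁻¹ * lumped T (fun x => phiPlus (extZero Φ.1 x)) (extZero χ.1)
      - lumped T
        (fun x => cPot quarticPotential * (P.a / P.α) *
            S.rhoHat P.m (extZero Φold.1 x) (extZero Φ.1 x) * extZero W.1 x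
          - P.ε⁻¹ * phiMinus (extZero Φold.1 x))
        (extZero χ.1)
      = allenCahnResidual T G β μ₀ P S Φold Φ W χ := by
    intro χ
    rw [T.lumped_eq _ (fun i => kineticCoeff (gamma 1 G) β μ₀ (T.cellGrad i.1 Φold) *
        ((T.vertexEval i Φ - T.vertexEval i Φold) / P.τ)),
      T.lumped_eq _ (fun i => phiPlus (T.vertexEval i Φ)),
      T.lumped_eq _ (fun i => cPot quarticPotential * (P.a / P.α) *
          S.rhoHat P.m (T.vertexEval i Φold) (T.vertexEval i Φ) * T.vertexEval i W
        - P.ε⁻¹ * phiMinus (T.vertexEval i Φold)),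
      T.integral_matrix_grad (fun q p => anisoB 1 G q p)]
    · simp only [allenCahnResidual, anisoStiffness, LinearMap.add_apply, LinearMap.sum_apply,
        LinearMap.smul_apply, smul_eq_mul, fun s => anisoB_one G (T.cellGrad s Φold)
          (T.cellGrad s Φ)]
      rw [Finset.mul_sum, Finset.mul_sum, add_right_comm, ← Finset.sum_add_distrib,
        add_sub_right_comm, ← Finset.sum_sub_distrib]
      congr 1
      refine Finset.sum_congr rfl fun i _ => ?_
      simp only [T.vertexEval_apply]
      ring
    · intro i
      have h0 := T.tendsto_extZero Φold.1 i
      have h1 := T.tendsto_extZero Φ.1 i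
      have h2 := T.tendsto_extZero W.1 i
      exact ((((S.continuous_rhoHat (by linarith [P.two_le_m])).tendsto _).comp
        (h0.prodMk_nhds h1)).const_mul _ |>.mul h2).sub (h0.neg.const_mul _)
    · intro i
      exact (T.tendsto_extZero Φ.1 i).pow 3
    · intro i
      have h : Filter.Tendsto (fun x => kineticCoeff (gamma 1 G) β μ₀ (T.cellGrad i.1 Φold) *
          ((extZero Φ.1 x - extZero Φold.1 x) / P.τ)) (𝓝[openSimplex i.1.1] (i.2.1 : Space d))
          (𝓝 (kineticCoeff (gamma 1 G) β μ₀ (T.cellGrad i.1 Φold) *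
            ((T.vertexEval i Φ - T.vertexEval i Φold) / P.τ))) :=
        (((T.tendsto_extZero Φ.1 i).sub (T.tendsto_extZero Φold.1 i)).div_const _).const_mul _
      -- `kineticCoeff` need not be continuous; the limit exists because the old gradient is
      -- constant inside the cell.
      refine h.congr' ?_
      filter_upwards [self_mem_nhdsWithin] with x hx
      rw [T.grad_eq_cellGrad i.1 Φold hx]
  constructor
  · intro h
    ext χ
    rw [← key]
    exact sub_eq_zero.2 (h χ.1 χ.2)
  · intro h χ hχ
    have := key ⟨χ, hχ⟩
    rw [h] at this
    exact sub_eq_zero.1 this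

theorem isSolution_iff (T : Triangulation Ω) (ΓD : Set (Space d)) (uD : ℝ)
    (G : Fin L → Matrix (Fin d) (Fin d) ℝ) (β : Space d → ℝ) (μ₀ : ℝ) (P : Parameters)
    (S : Splitting) (Φold : feSpace T) (Wold : C(closure Ω, ℝ)) (Φ W : feSpace T) :
    IsSolution T ΓD uD 1 G β μ₀ P S Φold Wold Φ W ↔
      (∀ x : closure Ω, (x : Space d) ∈ ΓD → W.1 x = uD) ∧
      (∀ χ : feSpace T, (∀ x : closure Ω, (x : Space d) ∈ ΓD → χ.1 x = 0) →
        heatResidual T P S Φold Wold Φ W χ = 0) ∧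
      allenCahnResidual T G β μ₀ P S Φold Φ W = 0 := by
  rw [← heatEquation_iff T ΓD, ← allenCahnEquation_iff]
  exact ⟨fun h => ⟨h.mem_W.2, h.heat, h.allenCahn⟩,
    fun ⟨h1, h2, h3⟩ => ⟨Φ.2, ⟨W.2, h1⟩, h2, h3⟩⟩

end PhaseFieldFEM
end

/-! ### Solvability of the scheme and uniqueness for explicit shape functions. -/

noncomputable section
namespace PhaseFieldFEM

variable {d L : ℕ} {Ω : Set (Space d)}

/-! ### Existence -/

/-- Galerkin form of the scheme. Unknowns are the increment of `Φ` and the deviation of `W` from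
`uD`, the variables in which the coupling cancels. `X` and `Y` stay free, since on the full spaces
the heat form may degenerate on constants. -/
theorem exists_solution_on_submodules (T : Triangulation Ω)
    (G : Fin L → Matrix (Fin d) (Fin d) ℝ) (hG : ∀ l, (G l).PosDef)
    (β : Space d → ℝ) (hβ : IsMobility β) (μ₀ : ℝ)
    (hμ₀ : IsKineticValueAtZero (gamma 1 G) β μ₀) (P : Parameters) (uD : ℝ) (S : Splitting)
    (Φold : feSpace T) (Wold : C(closure Ω, ℝ)) (X Y : Submodule ℝ (feSpace T))
    (hY : ∀ w ∈ Y, w ≠ 0 → 0 < T.mass (fun i => P.ϑ / P.τ * T.weight i) w w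
      + T.stiffness (fun s => conductivity T P Φold s • LinearMap.id) w w) :
    ∃ φ ∈ X, ∃ w ∈ Y,
      (∀ χ ∈ X, allenCahnResidual T G β μ₀ P S Φold (Φold + φ) (T.const uD + w) χ = 0) ∧
      (∀ χ ∈ Y, heatResidual T P S Φold Wold (Φold + φ) (T.const uD + w) χ = 0) := by
  have := T.compactSpace
  have := T.finiteDimensional
  have hm : (0 : ℝ) ≤ P.m := by linarith [P.two_le_m]
  have hτ := P.τ_pos
  have hε := P.ε_pos
  have hα := P.α_pos
  have hρ := P.ρ_nonneg
  let A : X →ₗ[ℝ] X →ₗ[ℝ] ℝ := (T.mass (fun i => P.ε * (P.ρ / P.α) / P.τ *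
      kineticCoeff (gamma 1 G) β μ₀ (T.cellGrad i.1 Φold) * T.weight i)
    + P.ε • anisoStiffness T G Φold).domRestrict₁₂ X X
  let K : Y →ₗ[ℝ] Y →ₗ[ℝ] ℝ := (T.mass (fun i => P.ϑ / P.τ * T.weight i)
    + T.stiffness (fun s => conductivity T P Φold s • LinearMap.id)).domRestrict₁₂ Y Y
  let ℓ : X →ₗ[ℝ] ℝ := (P.ε • anisoStiffness T G Φold Φold + ∑ i, (T.weight i *
    (P.ε⁻¹ * phiMinus (T.vertexEval i Φold))) • T.vertexEval i) ∘ₗ X.subtype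
  let ℓ' : Y →ₗ[ℝ] ℝ := (∑ i, (T.weight i * (P.ϑ * ((uD - Wold (T.vertex i)) / P.τ))) •
    T.vertexEval i) ∘ₗ Y.subtype
  have hA : ∀ x, 0 ≤ A x x := by
    intro x
    rw [LinearMap.domRestrict₁₂_apply, LinearMap.add_apply, LinearMap.add_apply, T.mass_apply]
    refine add_nonneg (Finset.sum_nonneg fun i _ => ?_)
      (mul_nonneg hε.le (anisoStiffness_self_nonneg T hG _ _))
    have h1 := kineticCoeff_nonneg hβ hμ₀ (T.cellGrad i.1 Φold)
    have h2 := (T.weight_pos i).le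
    exact mul_nonneg (by positivity) (mul_self_nonneg _)
  have hK : ∀ y, y ≠ 0 → 0 < K y y := fun y hy => hY y.1 y.2 (by simpa using hy)
  obtain ⟨φ, w, hφ, hw⟩ := exists_coupled_solution (X := X) (Y := Y)
    (fun i => T.vertexEval i ∘ₗ X.subtype)
    (fun x hx => Subtype.ext (T.eq_zero_of_vertexEval x.1 hx))
    (fun i => T.vertexEval i ∘ₗ Y.subtype)
    T.weight (fun i => T.vertexEval i Φold) T.weight_pos
    (fun i s => S.rhoHat P.m (T.vertexEval i Φold) (T.vertexEval i Φold + s))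
    (fun i => (S.continuous_rhoHat hm).comp
      (continuous_const.prodMk (continuous_const.add continuous_id)))
    ((∑ i, |S.rhoMinus (T.vertexEval i Φold)|) + 3 / 2 * P.m)
    (fun i s => (abs_add_le _ _).trans (add_le_add
      (Finset.single_le_sum (f := fun i => |S.rhoMinus (T.vertexEval i Φold)|)
        (fun _ _ => abs_nonneg _) (Finset.mem_univ i))
      (S.abs_rhoPlusCut_le hm _)))
    A hA K hK ℓ ℓ'
    P.ε⁻¹ (cPot quarticPotential * (P.a / P.α)) (P.lam / P.τ) uD (inv_pos.2 hε)
    (mul_pos cPot_quarticPotential_pos (div_pos P.a_pos hα)) (div_pos P.lam_pos hτ)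
  refine ⟨φ.1, φ.2, w.1, w.2, fun χ hχ => ?_, fun χ hχ => ?_⟩
  · have h := hφ ⟨χ, hχ⟩
    simp only [A, ℓ, LinearMap.domRestrict₁₂_apply, LinearMap.add_apply, T.mass_apply,
      LinearMap.smul_apply, LinearMap.comp_apply, Submodule.subtype_apply, LinearMap.sum_apply,
      smul_eq_mul] at h
    rw [← sub_eq_zero, Finset.mul_sum, Finset.mul_sum] at h
    simp only [allenCahnResidual, LinearMap.add_apply, LinearMap.sum_apply,
      LinearMap.smul_apply, smul_eq_mul, map_add, T.vertexEval_const]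
    have hsum : ∀ (f f₁ f₂ f₃ f₄ : T.CellVertex → ℝ) (r₁ r₂ : ℝ),
        (∀ i, f i = f₁ i + f₂ i + f₃ i - f₄ i) →
        (∑ i, f₁ i) + r₂ + (r₁ + ∑ i, f₂ i) + (∑ i, f₃ i) - ∑ i, f₄ i = 0 →
        (∑ i, f i) + (r₁ + r₂) = 0 := by
      intro f f₁ f₂ f₃ f₄ r₁ r₂ hf h0
      simp only [hf, Finset.sum_add_distrib, Finset.sum_sub_distrib]
      linarith
    rw [mul_add P.ε]
    refine hsum _ _ _ _ _ _ _ (fun i => ?_) h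
    simp only [phiPlus]
    ring
  · have h := hw ⟨χ, hχ⟩
    simp only [K, ℓ', LinearMap.domRestrict₁₂_apply, LinearMap.add_apply, T.mass_apply,
      LinearMap.comp_apply, Submodule.subtype_apply, LinearMap.sum_apply,
      LinearMap.smul_apply, smul_eq_mul] at h
    rw [Finset.mul_sum] at h
    simp only [heatResidual, LinearMap.add_apply, LinearMap.sum_apply,
      LinearMap.smul_apply, smul_eq_mul, map_add, T.vertexEval_const, T.stiffness_const_left,
      zero_add]
    have hsum : ∀ (f f₁ f₂ f₃ : T.CellVertex → ℝ) (r : ℝ),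
        (∀ i, f i = f₁ i + f₂ i + f₃ i) →
        (∑ i, f₁ i) + r + (∑ i, f₂ i) + (∑ i, f₃ i) = 0 → (∑ i, f i) + r = 0 := by
      intro f f₁ f₂ f₃ r hf h0
      simp only [hf, Finset.sum_add_distrib]
      linarith
    refine hsum _ _ _ _ _ (fun i => ?_) h
    ring

/-- Existence if the heat equation determines the temperature, or if the shape function is
treated explicitly and there is no Dirichlet boundary. -/
theorem exists_isSolution (hΩ : IsConnected Ω) (T : Triangulation Ω)
    (ΓD : Set (Space d)) (G : Fin L → Matrix (Fin d) (Fin d) ℝ) (hG : ∀ l, (G l).PosDef)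
    (β : Space d → ℝ) (hβ : IsMobility β) (μ₀ : ℝ)
    (hμ₀ : IsKineticValueAtZero (gamma 1 G) β μ₀) (P : Parameters) (uD : ℝ) (S : Splitting)
    (Φold : feSpace T) (Wold : C(closure Ω, ℝ))
    (h : 0 < P.ϑ ∨ (∃ x : closure Ω, (x : Space d) ∈ ΓD) ∨ S = .i ∨ S = .ii ∨ S = .iiPos) :
    ∃ Φ W, IsSolution T ΓD uD 1 G β μ₀ P S Φold Wold Φ W := by
  have hτ := P.τ_pos
  have hid : ∀ s : T.cells, ∀ v : Space d, 0 ≤ inner ℝ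
      ((conductivity T P Φold s • LinearMap.id : Space d →ₗ[ℝ] Space d) v) v := by
    intro s v
    rw [LinearMap.smul_apply, inner_smul_left]
    exact mul_nonneg (by simpa using (conductivity_pos T P Φold s).le) real_inner_self_nonneg
  have hexists : ∀ w : feSpace T, w ≠ 0 → ∃ i, T.vertexEval i w ≠ 0 := by
    intro w hw
    by_contra! h0
    exact hw (T.eq_zero_of_vertexEval w h0)
  have hmass : ∀ w, 0 ≤ T.mass (fun i => P.ϑ / P.τ * T.weight i) w w := by
    intro w
    rw [T.mass_apply]
    have := P.ϑ_nonneg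
    exact Finset.sum_nonneg fun i _ =>
      mul_nonneg (mul_nonneg (by positivity) (T.weight_pos i).le) (mul_self_nonneg _)
  by_cases hdet : 0 < P.ϑ ∨ ∃ x : closure Ω, (x : Space d) ∈ ΓD
  · let Y : Submodule ℝ (feSpace T) :=
      { carrier := {χ | ∀ x : closure Ω, (x : Space d) ∈ ΓD → χ.1 x = 0}
        add_mem' := fun {a b} ha hb x hx => by
          change a.1 x + b.1 x = 0
          rw [ha x hx, hb x hx, add_zero]
        zero_mem' := fun _ _ => rfl
        smul_mem' := fun c a ha x hx => by
          change c * a.1 x = 0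
          rw [ha x hx, mul_zero] }
    obtain ⟨φ, -, w, hw, h1, h2⟩ := exists_solution_on_submodules T G hG β hβ μ₀ hμ₀ P uD S
      Φold Wold ⊤ Y (by
        intro w hw hw0
        have hs := T.stiffness_self_nonneg _ hid w
        rcases hdet with hϑ | ⟨x, hx⟩
        · refine add_pos_of_pos_of_nonneg ?_ hs
          obtain ⟨i, hi⟩ := hexists w hw0
          rw [T.mass_apply]
          refine Finset.sum_pos' (fun j _ => ?_) ⟨i, Finset.mem_univ i, ?_⟩
          · exact mul_nonneg (mul_nonneg (by positivity) (T.weight_pos j).le)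
              (mul_self_nonneg _)
          · have := T.weight_pos i
            have := mul_self_pos.2 hi
            positivity
        · refine add_pos_of_nonneg_of_pos (hmass w) ?_
          by_contra! hle
          -- Only constants have zero Dirichlet energy, and the zero trace at `x` excludes nonzero
          -- ones.
          obtain ⟨c, rfl⟩ := T.eq_const_of_stiffness hΩ _ (conductivity_pos T P Φold) w hle
          have hc : c = 0 := hw x hx
          exact hw0 (by rw [hc]; rfl))
    refine ⟨(Φold + φ : feSpace T).1, (T.const uD + w).1,
      (isSolution_iff T ΓD uD G β μ₀ P S Φold Wold _ _).2 ⟨fun x hx => ?_, h2, ?_⟩⟩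
    · change uD + w.1 x = uD
      rw [hw x hx, add_zero]
    · ext χ
      exact h1 χ trivial
  · push Not at hdet
    have hϑ : P.ϑ = 0 := le_antisymm hdet.1 P.ϑ_nonneg
    have hS : S = .i ∨ S = .ii ∨ S = .iiPos := by
      rcases h with h | ⟨x, hx⟩ | h
      · exact absurd h (not_lt.2 hdet.1)
      · exact absurd hx (hdet.2 x)
      · exact h
    -- Up to the factor `λ / τ`, `f` applied to the increment of `Φ` is the heat equation tested
    -- with 1. The increment is sought in `ker f`, and `W - uD` among the functions of zero mean,
    -- where the Dirichlet energy is definite.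
    let f : feSpace T →ₗ[ℝ] ℝ :=
      ∑ i, (T.weight i * S.rho (T.vertexEval i Φold)) • T.vertexEval i
    let avg : feSpace T →ₗ[ℝ] ℝ := ∑ i, T.weight i • T.vertexEval i
    have hf : ∀ u, f u = ∑ i, T.weight i * S.rho (T.vertexEval i Φold) * T.vertexEval i u := by
      intro u
      simp [f, LinearMap.sum_apply]
    have havg : ∀ c, avg (T.const c) = (∑ i, T.weight i) * c := by
      intro c
      simp [avg, LinearMap.sum_apply, T.vertexEval_const, Finset.sum_mul]
    have hwt : 0 < ∑ i, T.weight i := by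
      obtain ⟨x, hx⟩ := hΩ.nonempty
      obtain ⟨s, hs, -⟩ := T.exists_mem_closedSimplex ⟨x, subset_closure hx⟩
      obtain ⟨p, hp⟩ : s.Nonempty := by
        rw [← Finset.card_pos, T.card_eq s hs]
        omega
      exact Finset.sum_pos (fun i _ => T.weight_pos i) ⟨⟨⟨s, hs⟩, ⟨p, hp⟩⟩, Finset.mem_univ _⟩
    obtain ⟨φ, hφ, w, hw, h1, h2⟩ := exists_solution_on_submodules T G hG β hβ μ₀ hμ₀ P uD S
      Φold Wold (LinearMap.ker f) (LinearMap.ker avg) (by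
        intro w hw hw0
        refine add_pos_of_nonneg_of_pos (hmass w) ?_
        by_contra! hle
        obtain ⟨c, rfl⟩ := T.eq_const_of_stiffness hΩ _ (conductivity_pos T P Φold) w hle
        rw [LinearMap.mem_ker, havg] at hw
        have hc : c = 0 := (mul_eq_zero.1 hw).resolve_left hwt.ne'
        exact hw0 (by rw [hc]; rfl))
    set Φ : feSpace T := Φold + φ
    set W : feSpace T := T.const uD + w
    -- A functional vanishing on `ker f` is a multiple of `f`; the factor is the Lagrange
    -- multiplier.
    have hspan := mem_span_of_iInf_ker_le_ker (ι := Unit) (L := fun _ => f)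
      (K := allenCahnResidual T G β μ₀ P S Φold Φ W) (by
        rw [iInf_const]
        exact fun χ hχ => h1 χ hχ)
    rw [Set.range_const, Submodule.mem_span_singleton] at hspan
    obtain ⟨c, hc⟩ := hspan
    set κ := cPot quarticPotential * (P.a / P.α)
    have hκ : 0 < κ := mul_pos cPot_quarticPotential_pos (div_pos P.a_pos P.α_pos)
    -- Adding a constant `t` to `W` changes the Allen–Cahn residual by `-κ t f` and, as `ϑ = 0`,
    -- leaves the heat residual alone; `t = c / κ` removes the multiplier.
    refine ⟨Φ.1, (W + T.const (c / κ)).1, (isSolution_iff T ΓD uD G β μ₀ P S Φold Wold _ _).2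
      ⟨fun x hx => absurd hx (hdet.2 x), fun χ _ => ?_, ?_⟩⟩
    · have hW : heatResidual T P S Φold Wold Φ (W + T.const (c / κ))
          = heatResidual T P S Φold Wold Φ W := by
        ext ξ
        simp [heatResidual, hϑ, T.stiffness_const_left]
      have hconst : ∀ t, heatResidual T P S Φold Wold Φ W (T.const t) = 0 := by
        intro t
        rw [LinearMap.mem_ker, hf] at hφ
        simp only [heatResidual, LinearMap.add_apply, LinearMap.sum_apply, LinearMap.smul_apply,
          smul_eq_mul, hϑ, zero_mul, zero_add, T.stiffness_const_right, add_zero,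
          T.vertexEval_const, Splitting.rhoHat_eq_rho hS, Φ, map_add, add_sub_cancel_left]
        rw [← mul_zero (P.lam / P.τ * t), ← hφ, Finset.mul_sum]
        exact Finset.sum_congr rfl fun i _ => by ring
      -- Every test function is a constant plus a function of zero mean, and the heat residual
      -- vanishes on both.
      set t := avg χ / ∑ i, T.weight i
      have hmem : χ - T.const t ∈ LinearMap.ker avg := by
        rw [LinearMap.mem_ker, map_sub, havg, mul_div_cancel₀ _ hwt.ne', sub_self]
      have h3 := h2 _ hmem
      rw [map_sub, hconst, sub_zero] at h3
      rw [hW, h3]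
    · ext χ
      have h3 : allenCahnResidual T G β μ₀ P S Φold Φ W χ = c * f χ := by
        rw [← hc]
        rfl
      have h4 : allenCahnResidual T G β μ₀ P S Φold Φ (W + T.const (c / κ)) χ
          = allenCahnResidual T G β μ₀ P S Φold Φ W χ - κ * (c / κ) * f χ := by
        rw [hf]
        simp only [allenCahnResidual, LinearMap.add_apply, LinearMap.sum_apply,
          LinearMap.smul_apply, smul_eq_mul, Splitting.rhoHat_eq_rho hS, map_add,
          T.vertexEval_const]
        rw [add_sub_right_comm, Finset.mul_sum, ← Finset.sum_sub_distrib]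
        congr 1
        refine Finset.sum_congr rfl fun i _ => ?_
        ring
      rw [h4, h3, mul_div_cancel₀ _ hκ.ne', sub_self]
      rfl

/-! ### Uniqueness -/

theorem mul_sub_cube_nonneg (x y : ℝ) : 0 ≤ (x ^ 3 - y ^ 3) * (x - y) := by
  nlinarith [mul_nonneg (sq_nonneg (x - y)) (sq_nonneg (x + y)),
    mul_nonneg (sq_nonneg (x - y)) (sq_nonneg x), mul_nonneg (sq_nonneg (x - y)) (sq_nonneg y)]

theorem eq_of_mul_sub_cube_eq_zero {x y : ℝ} (h : (x ^ 3 - y ^ 3) * (x - y) = 0) : x = y := by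
  rcases mul_eq_zero.1 h with h | h
  · exact (Odd.strictMono_pow (by decide : Odd 3)).injective (sub_eq_zero.1 h)
  · exact sub_eq_zero.1 h

/-- An energy argument for the difference of two solutions: both equations, tested with the
differences, contain the same coupling sum `R`, once on the side of the dissipative terms and once
opposite to them. -/
theorem uniqueness_of_explicit_shape (hΩ : IsConnected Ω) (T : Triangulation Ω)
    (ΓD : Set (Space d)) (G : Fin L → Matrix (Fin d) (Fin d) ℝ) (hG : ∀ l, (G l).PosDef)
    (β : Space d → ℝ) (hβ : IsMobility β) (μ₀ : ℝ)
    (hμ₀ : IsKineticValueAtZero (gamma 1 G) β μ₀) (P : Parameters) (uD : ℝ) {S : Splitting}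
    (hS : S = .i ∨ S = .ii ∨ S = .iiPos) (Φold : feSpace T) (Wold : C(closure Ω, ℝ))
    (Φ W Φ' W' : feSpace T) (h : IsSolution T ΓD uD 1 G β μ₀ P S Φold Wold Φ W)
    (h' : IsSolution T ΓD uD 1 G β μ₀ P S Φold Wold Φ' W') :
    Φ = Φ' ∧ (∃ c : ℝ, W = W' + T.const c) ∧
      (0 < P.ϑ ∨ (∃ x : closure Ω, (x : Space d) ∈ ΓD) ∨
        (∃ p ∈ T.nodes, S.rho (Φold.1 p) ≠ 0) → W = W') := by
  rw [isSolution_iff] at h h'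
  obtain ⟨hD, hH, hA⟩ := h
  obtain ⟨hD', hH', hA'⟩ := h'
  have hτ := P.τ_pos
  have hε := P.ε_pos
  have hlam := P.lam_pos
  have hα := P.α_pos
  have hρ := P.ρ_nonneg
  have hϑ := P.ϑ_nonneg
  set κ := cPot quarticPotential * (P.a / P.α)
  have hκ : 0 < κ := mul_pos cPot_quarticPotential_pos (div_pos P.a_pos P.α_pos)
  have hwD : ∀ x : closure Ω, (x : Space d) ∈ ΓD → (W - W').1 x = 0 := by
    intro x hx
    change W.1 x - W'.1 x = 0
    rw [hD x hx, hD' x hx, sub_self]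
  have hheat := congrArg₂ (· - ·) (hH (W - W') hwD) (hH' (W - W') hwD)
  have hac : ∀ χ, κ * ∑ i, T.weight i * (S.rho (T.vertexEval i Φold) *
        (T.vertexEval i W - T.vertexEval i W') * T.vertexEval i χ)
      = P.ε * (P.ρ / P.α) / P.τ * (∑ i, T.weight i *
          (kineticCoeff (gamma 1 G) β μ₀ (T.cellGrad i.1 Φold) *
            (T.vertexEval i Φ - T.vertexEval i Φ') * T.vertexEval i χ))
        + P.ε⁻¹ * (∑ i, T.weight i *
          ((T.vertexEval i Φ ^ 3 - T.vertexEval i Φ' ^ 3) * T.vertexEval i χ))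
        + P.ε * anisoStiffness T G Φold (Φ - Φ') χ := by
    intro χ
    have h1 := congrArg (fun l => l χ) (hA.trans hA'.symm)
    simp only [allenCahnResidual, LinearMap.add_apply, LinearMap.sum_apply,
      LinearMap.smul_apply, smul_eq_mul, Splitting.rhoHat_eq_rho hS, phiPlus] at h1
    rw [map_sub, LinearMap.sub_apply]
    simp only [Finset.mul_sum]
    have hsum : ∀ (f f' f₁ f₂ f₃ : T.CellVertex → ℝ) (r r' : ℝ),
        (∀ i, f i - f' i = f₁ i + f₂ i - f₃ i) → (∑ i, f i) + P.ε * r = (∑ i, f' i) + P.ε * r' →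
        ∑ i, f₃ i = (∑ i, f₁ i) + (∑ i, f₂ i) + P.ε * (r - r') := by
      intro f f' f₁ f₂ f₃ r r' hf h0
      have h1 := Finset.sum_congr rfl fun i (_ : i ∈ Finset.univ) => hf i
      simp only [Finset.sum_add_distrib, Finset.sum_sub_distrib] at h1
      linarith
    refine hsum _ _ _ _ _ _ _ (fun i => ?_) h1
    ring
  have hheat' : P.ϑ / P.τ * (∑ i, T.weight i *
        (T.vertexEval i W - T.vertexEval i W') ^ 2)
      + P.lam / P.τ * (∑ i, T.weight i * (S.rho (T.vertexEval i Φold) *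
        (T.vertexEval i W - T.vertexEval i W') * T.vertexEval i (Φ - Φ')))
      + T.stiffness (fun s => conductivity T P Φold s • LinearMap.id) (W - W') (W - W') = 0 := by
    simp only [heatResidual, LinearMap.add_apply, LinearMap.sum_apply,
      LinearMap.smul_apply, smul_eq_mul, Splitting.rhoHat_eq_rho hS, sub_zero] at hheat
    rw [map_sub (T.stiffness _), LinearMap.sub_apply]
    simp only [Finset.mul_sum]
    have hsum : ∀ (f f' f₁ f₂ : T.CellVertex → ℝ) (r r' : ℝ),
        (∀ i, f i - f' i = f₁ i + f₂ i) → (∑ i, f i) + r - ((∑ i, f' i) + r') = 0 →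
        (∑ i, f₁ i) + (∑ i, f₂ i) + (r - r') = 0 := by
      intro f f' f₁ f₂ r r' hf h0
      have h1 := Finset.sum_congr rfl fun i (_ : i ∈ Finset.univ) => hf i
      simp only [Finset.sum_add_distrib, Finset.sum_sub_distrib] at h1
      linarith
    refine hsum _ _ _ _ _ _ (fun i => ?_) hheat
    simp only [map_sub]
    ring
  have hac' := hac (Φ - Φ')
  set R := ∑ i, T.weight i * (S.rho (T.vertexEval i Φold) *
    (T.vertexEval i W - T.vertexEval i W') * T.vertexEval i (Φ - Φ'))
  set S₁ := ∑ i, T.weight i * (T.vertexEval i W - T.vertexEval i W') ^ 2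
  set S₂ := ∑ i, T.weight i * (kineticCoeff (gamma 1 G) β μ₀ (T.cellGrad i.1 Φold) *
    (T.vertexEval i Φ - T.vertexEval i Φ') * T.vertexEval i (Φ - Φ'))
  set S₃ := ∑ i, T.weight i *
    ((T.vertexEval i Φ ^ 3 - T.vertexEval i Φ' ^ 3) * T.vertexEval i (Φ - Φ'))
  have hS₁0 : 0 ≤ S₁ := Finset.sum_nonneg fun i _ =>
    mul_nonneg (T.weight_pos i).le (sq_nonneg _)
  have hS₂0 : 0 ≤ S₂ := Finset.sum_nonneg fun i _ => by
    rw [map_sub, mul_assoc (kineticCoeff _ _ _ _)]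
    exact mul_nonneg (T.weight_pos i).le
      (mul_nonneg (kineticCoeff_nonneg hβ hμ₀ _) (mul_self_nonneg _))
  have hterm : ∀ i ∈ (Finset.univ : Finset T.CellVertex), 0 ≤ T.weight i *
      ((T.vertexEval i Φ ^ 3 - T.vertexEval i Φ' ^ 3) * T.vertexEval i (Φ - Φ')) := by
    intro i _
    rw [map_sub]
    exact mul_nonneg (T.weight_pos i).le (mul_sub_cube_nonneg _ _)
  have hS₃0 : 0 ≤ S₃ := Finset.sum_nonneg hterm
  have hK0 : 0 ≤ T.stiffness (fun s => conductivity T P Φold s • LinearMap.id)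
      (W - W') (W - W') := by
    refine T.stiffness_self_nonneg _ (fun s v => ?_) _
    rw [LinearMap.smul_apply, inner_smul_left]
    exact mul_nonneg (by simpa using (conductivity_pos T P Φold s).le) real_inner_self_nonneg
  have hB0 := anisoStiffness_self_nonneg T hG Φold (Φ - Φ')
  have p1 : 0 ≤ P.ϑ / P.τ * S₁ := by positivity
  have p2 : 0 ≤ P.ε * (P.ρ / P.α) / P.τ * S₂ := by positivity
  have p3 : 0 ≤ P.ε⁻¹ * S₃ := by positivity
  have p4 : 0 ≤ P.ε * anisoStiffness T G Φold (Φ - Φ') (Φ - Φ') := by positivity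
  -- The heat equation writes `-R` and the Allen–Cahn equation `R`, up to positive factors, as a sum
  -- of nonnegative terms. With `R = 0` each of these terms is zero.
  have hR : R = 0 := by
    refine le_antisymm ?_ ?_
    · have : P.lam / P.τ * R ≤ 0 := by linarith
      by_contra! hpos
      have : 0 < P.lam / P.τ * R := by positivity
      linarith
    · by_contra! hneg
      have := mul_neg_of_pos_of_neg hκ hneg
      linarith
  rw [hR, mul_zero] at hac' hheat'
  have hS₃z : S₃ = 0 := by
    have : P.ε⁻¹ * S₃ = 0 := by linarith
    exact (mul_eq_zero.1 this).resolve_left (inv_pos.2 hε).ne'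
  have hΦ : Φ = Φ' := by
    rw [← sub_eq_zero]
    refine T.eq_zero_of_vertexEval _ fun i => ?_
    have h1 := (Finset.sum_eq_zero_iff_of_nonneg hterm).1 hS₃z i (Finset.mem_univ i)
    have h2 := (mul_eq_zero.1 h1).resolve_left (T.weight_pos i).ne'
    rw [map_sub] at h2 ⊢
    exact sub_eq_zero.2 (eq_of_mul_sub_cube_eq_zero h2)
  obtain ⟨c, hc⟩ := T.eq_const_of_stiffness hΩ _ (conductivity_pos T P Φold) (W - W')
    (by linarith)
  refine ⟨hΦ, ⟨c, by rw [← hc]; abel⟩, fun hcase => ?_⟩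
  suffices hc0 : c = 0 by
    rw [← sub_eq_zero, hc, hc0]
    rfl
  have hev : ∀ i, T.vertexEval i W - T.vertexEval i W' = c := by
    intro i
    rw [← map_sub, hc, T.vertexEval_const]
  have hvertex : ∀ p ∈ T.nodes, ∃ i, T.vertex i = p := by
    rintro p ⟨s, hs, hp⟩
    exact ⟨⟨⟨s, hs⟩, ⟨p, hp⟩⟩, rfl⟩
  have hwt : ∀ i : T.CellVertex, ∑ j, T.weight j * c ^ 2 = 0 → c = 0 := by
    intro i h0
    have h1 := (Finset.sum_eq_zero_iff_of_nonneg fun j _ =>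
      mul_nonneg (T.weight_pos j).le (sq_nonneg c)).1 h0 i (Finset.mem_univ i)
    simpa [(T.weight_pos i).ne'] using h1
  rcases hcase with hcase | ⟨x, hx⟩ | ⟨p, hp, hne⟩
  · have hS₁z : P.ϑ / P.τ * S₁ = 0 := by linarith
    have hS₁z' := (mul_eq_zero.1 hS₁z).resolve_left (div_pos hcase hτ).ne'
    simp only [S₁, hev] at hS₁z'
    obtain ⟨x, hx⟩ := hΩ.nonempty
    obtain ⟨s, hs, -⟩ := T.exists_mem_closedSimplex ⟨x, subset_closure hx⟩
    obtain ⟨p, hp⟩ : s.Nonempty := by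
      rw [← Finset.card_pos, T.card_eq s hs]
      omega
    exact hwt ⟨⟨s, hs⟩, ⟨p, hp⟩⟩ hS₁z'
  · have := hwD x hx
    rw [hc] at this
    exact this
  · obtain ⟨i, rfl⟩ := hvertex p hp
    -- Testing with the interpolant of `ϱ(Φold)` turns the remaining Allen–Cahn identity into `c`
    -- times a weighted sum of squares, one of which is nonzero.
    obtain ⟨χ, hχ, hχv⟩ := exists_nodalInterpolant T fun x => S.rho (Φold.1 x)
    have h1 := hac ⟨χ, hχ⟩
    have hval : ∀ j, T.vertexEval j ⟨χ, hχ⟩ = S.rho (T.vertexEval j Φold) := fun j =>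
      hχv _ ⟨j.1.1, j.1.2, j.2.2⟩
    simp only [hΦ, sub_self, mul_zero, zero_mul, Finset.sum_const_zero, map_zero,
      LinearMap.zero_apply, add_zero, hev, hval] at h1
    have h2 := (mul_eq_zero.1 h1).resolve_left hκ.ne'
    have h3 : (∑ j, T.weight j * S.rho (T.vertexEval j Φold) ^ 2) * c = 0 := by
      rw [Finset.sum_mul, ← h2]
      exact Finset.sum_congr rfl fun j _ => by ring
    refine (mul_eq_zero.1 h3).resolve_left (Finset.sum_pos' (fun j _ => ?_)
      ⟨i, Finset.mem_univ i, ?_⟩).ne'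
    · exact mul_nonneg (T.weight_pos j).le (sq_nonneg _)
    · exact mul_pos (T.weight_pos i) (sq_pos_of_ne_zero hne)

end PhaseFieldFEM
end

/-! ### The theorem. -/

open PhaseFieldFEM in
theorem corollary3p2 {d L : ℕ} (hd : d = 2 ∨ d = 3) (hL : 0 < L)
    (Ω ΓD : Set (Space d)) (hΩ : IsOpen Ω) (hΩc : IsConnected Ω)
    (hΓ : AdmissibleBoundary Ω ΓD) (T : Triangulation Ω)
    (G : Fin L → Matrix (Fin d) (Fin d) ℝ) (hG : ∀ l, (G l).PosDef)
    (β : Space d → ℝ) (hβ : IsMobility β)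
    (μ₀ : ℝ) (hμ₀ : IsKineticValueAtZero (gamma 1 G) β μ₀)
    (P : Parameters) (uD : ℝ) (S : Splitting)
    (Φold Wold : C(closure Ω, ℝ)) (hΦold : Φold ∈ feSpace T)
    (hWold : 0 < P.ϑ → Wold ∈ feSpaceWithTrace T ΓD uD) :
    (¬ ((S = .iii ∨ S = .iiiPos) ∧ P.ϑ = 0 ∧ neumannBoundary Ω ΓD = frontier Ω) →
      ∃ Φ W, IsSolution T ΓD uD 1 G β μ₀ P S Φold Wold Φ W) ∧
    (S = .i ∨ S = .ii ∨ S = .iiPos →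
      ∀ Φ W Φ' W', IsSolution T ΓD uD 1 G β μ₀ P S Φold Wold Φ W →
        IsSolution T ΓD uD 1 G β μ₀ P S Φold Wold Φ' W' →
        Φ = Φ' ∧ (∃ c : ℝ, ∀ x, W x = W' x + c) ∧
        (0 < P.ϑ ∨ neumannBoundary Ω ΓD ≠ frontier Ω ∨ (∃ p ∈ T.nodes, S.rho (Φold p) ≠ 0) →
          W = W')) := by
  -- Removing `ΓD` changes the frontier only if some frontier point lies in `ΓD`. One such point is
  -- all that is needed to exclude nonzero constants.
  have hneu : neumannBoundary Ω ΓD ≠ frontier Ω → ∃ x : closure Ω, (x : Space d) ∈ ΓD := by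
    intro hne
    by_contra! h
    refine hne (Disjoint.sdiff_eq_left ?_)
    exact Set.disjoint_left.2 fun x hx hxD => h ⟨x, frontier_subset_closure hx⟩ hxD
  refine ⟨fun hnot => ?_, fun hS Φ W Φ' W' h h' => ?_⟩
  · refine exists_isSolution hΩc T ΓD G hG β hβ μ₀ hμ₀ P uD S ⟨Φold, hΦold⟩ Wold ?_
    by_cases hϑ : 0 < P.ϑ
    · exact Or.inl hϑ
    have hϑ0 : P.ϑ = 0 := le_antisymm (not_lt.1 hϑ) P.ϑ_nonneg
    by_cases hN : neumannBoundary Ω ΓD = frontier Ω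
    · have hS : ¬ (S = .iii ∨ S = .iiiPos) := fun h => hnot ⟨h, hϑ0, hN⟩
      cases S <;> simp_all
    · exact Or.inr (Or.inl (hneu hN))
  · obtain ⟨h1, ⟨c, hc⟩, h3⟩ := uniqueness_of_explicit_shape hΩc T ΓD G hG β hβ μ₀ hμ₀ P uD hS
      ⟨Φold, hΦold⟩ Wold ⟨Φ, h.mem_Φ⟩ ⟨W, h.mem_W.1⟩ ⟨Φ', h'.mem_Φ⟩ ⟨W', h'.mem_W.1⟩ h h'
    refine ⟨congrArg Subtype.val h1, ⟨c, fun x => ?_⟩, fun hcase => ?_⟩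
    · have := congrArg (fun u : feSpace T => u.1 x) hc
      exact this
    · exact congrArg Subtype.val (h3 (hcase.imp_right (Or.imp_left hneu)))
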